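/- Setting. Consider a Markov decision process with state space $\mathcal S$, action space $\mathcal A$, transition probabilities $\mathcal P(s'|s,a)$, initial distribution $\rho_0$, reward $\mathcal R(s,a)\in[-R,R]$ ($R>0$), discount factor $\gamma\in(0,1)$ and horizon $H$, and a family of policies with positive densities $\pi_\theta(a|s)$, $\theta\in\mathbb R^d$ (with respect to a fixed $\sigma$-finite reference measure on $\mathcal A$). A trajectory $\tau=(s_0,a_0,\dots,s_{H-1},a_{H-1})$ under $\pi_\theta$ has law $p(\tau|\theta)=\rho_0(s_0)\pi_\theta(a_0|s_0)\prod_{h=1}^{H-1}\mathcal P(s_h|s_{h-1},a_{h-1})\pi_\theta(a_h|s_h)$. Let $J(\theta)=\mathbb E_{\tau\sim p(\cdot|\theta)}\big[\sum_{h=0}^{H-1}\gamma^h\mathcal R(s_h,a_h)\big]$, let $g(\tau|\theta)=\sum_{h=0}^{H-1}\sum_{j=h}^{H-1}\gamma^j\mathcal R(s_j,a_j)\nabla_\theta\log\pi_\theta(a_h|s_h)$ be the PGT gradient estimator, and let $w(\tau|\theta',\theta)=\prod_{h=0}^{H-1}\pi_{\theta'}(a_h|s_h)/\pi_\theta(a_h|s_h)$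 be the importance weight. Assumptions. There are constants $M_g,M_h,\sigma,W>0$ such that, for all $s,a,\theta,\theta'$: $\log\pi_\theta(a|s)$ is twice differentiable in $\theta$ with $\|\nabla_\theta\log\pi_\theta(a|s)\|\le M_g$ and $\|\nabla^2_\theta\log\pi_\theta(a|s)\|\le M_h$; $\mathbb E_{\tau\sim p(\cdot|\theta)}\|g(\tau|\theta)-\nabla J(\theta)\|^2\le\sigma^2$; and $\mathrm{Var}_{\tau\sim p(\cdot|\theta)}\big(w(\tau|\theta',\theta)\big)\le W$. Constants. Let $G=\frac{M_gR}{(1-\gamma)^2}$, $L=\max\Big\{\frac{M_hR}{(1-\gamma)^2},\ \sqrt{\tfrac{H^2M_g^4R^2+M_h^2R^2}{(1-\gamma)^4}}\Big\}$, $C_w=\sqrt{H(2HM_g^2+M_h)(W+1)}$, $B^2=L^2+2G^2C_w^2$, let $k>0$ be arbitrary, and let $c=\frac1{3k^3L}+104B^2$ and $m=\max\{2,(2Lk)^3,(\frac{ck}{2L})^3\}$. Algorithm (IS-MBPG*). Starting from a given $\theta_1\in\mathbb R^d$, for $t=1,\dots,T$ sample, given the past, one trajectory $\tau_t\sim p(\cdot|\theta_t)$;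 put $u_1=g(\tau_1|\theta_1)$ and, for $t\ge2$, $$u_t=\beta_t g(\tau_t|\theta_t)+(1-\beta_t)\big[u_{t-1}+g(\tau_t|\theta_t)-w(\tau_t|\theta_{t-1},\theta_t)g(\tau_t|\theta_{t-1})\big];$$ then set $\eta_t=\frac{k}{(m+t)^{1/3}}$, $\theta_{t+1}=\theta_t+\eta_tu_t$ and $\beta_{t+1}=c\eta_t^2$. The output is $\theta_\zeta$, with $\zeta$ uniform on $\{1,\dots,T\}$ and independent of the iterations. Theorem 3. $J$ is differentiable, $J^*=\sup_\theta J(\theta)<+\infty$, and for every $T\ge1$ the expectations below are finite and $$\mathbb E\|\nabla J(\theta_\zeta)\|=\frac1T\sum_{t=1}^T\mathbb E\|\nabla J(\theta_t)\|\le\frac{\sqrt{\Gamma_T}\,m^{1/6}}{\sqrt T}+\frac{\sqrt{\Gamma_T}}{T^{1/3}},$$ where $$\Gamma_T=\frac1k\Big(16(J^*-J(\theta_1))+\frac{m^{1/3}}{8B^2k}\sigma^2+\frac{c^2k^3\sigma^2}{4B^2}\ln(T+2)\Big)=O(\ln T)\quad(T\to\infty).$$ Consequently the sample complexity, with a single trajectory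 per iteration, is $O(\epsilon^{-3})$ up to a logarithmic factor: there is a constant $C>0$, independent of $\epsilon$, $T$ and the run, such that for every $\epsilon\in(0,1/2]$ and every $T\ge C\epsilon^{-3}(\ln(1/\epsilon))^{3/2}$, the $T$ sampled trajectories give $\mathbb E\|\nabla J(\theta_\zeta)\|\le\epsilon$. -/

import Mathlib

open MeasureTheory ProbabilityTheory Filter

set_option pp.deepTerms true

noncomputable section

namespace PolicyGradient

/-- A finite-horizon discounted Markov decision process with state space `S`, action space `A`,
transition kernel `P`, initial distribution `ρ₀`, reward `r` with values in `[-R, R]`,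
discount factor `γ ∈ (0, 1)` and time horizon `H`. -/
structure MDP (S A : Type*) [MeasurableSpace S] [MeasurableSpace A] where
  P : Kernel (S × A) S
  markov : IsMarkovKernel P
  ρ₀ : Measure S
  prob : IsProbabilityMeasure ρ₀
  r : S → A → ℝ
  measurable_r : Measurable (fun x : S × A => r x.1 x.2)
  R : ℝ
  R_pos : 0 < R
  abs_r_le : ∀ s a, |r s a| ≤ R
  γ : ℝ
  γ_pos : 0 < γ
  γ_lt_one : γ < 1
  H : ℕ

/-- A family of stochastic policies `π_θ(a|s)`, `θ ∈ ℝ^d`: for every `θ` and `s`, a positive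
probability density in `a` with respect to the reference measure `ν` on actions (the counting
measure for discrete actions, Lebesgue measure for continuous ones). -/
structure PolicyFamily (d : ℕ) (S : Type*) {A : Type*} [MeasurableSpace S] [MeasurableSpace A]
    (ν : Measure A) where
  dens : EuclideanSpace ℝ (Fin d) → S → A → ℝ
  measurable_dens : ∀ θ, Measurable (fun x : S × A => dens θ x.1 x.2)
  dens_pos : ∀ θ s a, 0 < dens θ s a
  lintegral_dens : ∀ θ s, ∫⁻ a, ENNReal.ofReal (dens θ s a) ∂ν = 1

/-- A trajectory `(s₀, a₀, …, s_{n-1}, a_{n-1})`. -/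
abbrev Traj (S A : Type*) (n : ℕ) : Type _ := Fin n → S × A

variable {S A : Type*} [MeasurableSpace S] [MeasurableSpace A]

/-- The reference measure `ν(da₀) P(ds₁|s₀,a₀) ν(da₁) ⋯ P(ds_{n-1}|s_{n-2},a_{n-2}) ν(da_{n-1})`
on trajectories of `n` steps that start in a given state `s₀`. (The state after the last step is
integrated out.) -/
def baseKernel (P : Kernel (S × A) S) (ν : Measure A) : (n : ℕ) → Kernel S (Traj S A n)
  | 0 => Kernel.const S (Measure.dirac Fin.elim0)
  | n + 1 =>
      ((Kernel.id ×ₖ Kernel.const S ν) ⊗ₖ Kernel.prodMkLeft S (baseKernel P ν n ∘ₖ P)).map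
        (fun x : (S × A) × Traj S A n => (Fin.cons x.1 x.2 : Traj S A (n + 1)))

instance baseKernel.isSFiniteKernel (P : Kernel (S × A) S) [IsMarkovKernel P] (ν : Measure A)
    [SFinite ν] (n : ℕ) : IsSFiniteKernel (baseKernel P ν n) := by
  induction n with
  | zero => unfold baseKernel; infer_instance
  | succ n ih => unfold baseKernel; infer_instance

/-- The reference measure `dτ = ρ₀(ds₀) ν(da₀) P(ds₁|s₀,a₀) ν(da₁) ⋯` on trajectories. -/
def baseMeasure (M : MDP S A) (ν : Measure A) : Measure (Traj S A M.H) :=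
  M.ρ₀.bind (baseKernel M.P ν M.H)

variable {d : ℕ} {ν : Measure A}

/-- The law `p(τ|θ) dτ = ρ₀(s₀) ∏ₕ P(s_{h+1}|sₕ,aₕ) π_θ(aₕ|sₕ) dτ` of a trajectory sampled with
the policy `π_θ`. -/
def trajLaw (M : MDP S A) (pol : PolicyFamily d S ν) (θ : EuclideanSpace ℝ (Fin d)) :
    Measure (Traj S A M.H) :=
  (baseMeasure M ν).withDensity
    (fun τ => ENNReal.ofReal (∏ h : Fin M.H, pol.dens θ (τ h).1 (τ h).2))

/-- The cumulative discounted reward `∑ₕ γ^h r(sₕ, aₕ)` of a trajectory. -/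
def trajReward (M : MDP S A) (τ : Traj S A M.H) : ℝ :=
  ∑ h : Fin M.H, M.γ ^ (h : ℕ) * M.r (τ h).1 (τ h).2

/-- The performance function `J(θ)`: the expected cumulative discounted reward. -/
def perf (M : MDP S A) (pol : PolicyFamily d S ν) (θ : EuclideanSpace ℝ (Fin d)) : ℝ :=
  ∫ τ, trajReward M τ ∂(trajLaw M pol θ)

/-- The score `∇_θ log π_θ(a|s)`. -/
def score (pol : PolicyFamily d S ν) (s : S) (a : A) (θ : EuclideanSpace ℝ (Fin d)) :
    EuclideanSpace ℝ (Fin d) :=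
  gradient (fun θ' => Real.log (pol.dens θ' s a)) θ

/-- The PGT stochastic gradient
`g(τ|θ) = ∑ₕ ∑_{j ≥ h} γ^j r(s_j, a_j) ∇_θ log π_θ(aₕ|sₕ)`. -/
def pgt (M : MDP S A) (pol : PolicyFamily d S ν) (τ : Traj S A M.H)
    (θ : EuclideanSpace ℝ (Fin d)) : EuclideanSpace ℝ (Fin d) :=
  ∑ h : Fin M.H, ∑ j ∈ Finset.Ici h,
    (M.γ ^ (j : ℕ) * M.r (τ j).1 (τ j).2) • score pol (τ h).1 (τ h).2 θ

/-- The importance sampling weight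
`w(τ|θ',θ) = p(τ|θ') / p(τ|θ) = ∏ₕ π_θ'(aₕ|sₕ) / π_θ(aₕ|sₕ)`. -/
def isWeight (pol : PolicyFamily d S ν) {n : ℕ} (τ : Traj S A n)
    (θ' θ : EuclideanSpace ℝ (Fin d)) : ℝ :=
  ∏ h : Fin n, pol.dens θ' (τ h).1 (τ h).2 / pol.dens θ (τ h).1 (τ h).2

/-- The log-density is twice differentiable in the parameter, with gradient bounded by `Mg` and
Hessian bounded by `Mh` in operator norm. -/
structure BoundedScore (pol : PolicyFamily d S ν) (Mg Mh : ℝ) : Prop where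
  differentiable_log : ∀ s a, Differentiable ℝ (fun θ => Real.log (pol.dens θ s a))
  differentiable_score : ∀ s a, Differentiable ℝ (score pol s a)
  norm_score_le : ∀ s a θ, ‖score pol s a θ‖ ≤ Mg
  norm_hessian_le : ∀ s a θ, ‖fderiv ℝ (score pol s a) θ‖ ≤ Mh

/-- The variance `E‖g(τ|θ) - ∇J(θ)‖²` of the stochastic gradient is at most `σ²`, for all `θ`. -/
def BoundedGradientVariance (M : MDP S A) (pol : PolicyFamily d S ν) (σ : ℝ) : Prop :=
  ∀ θ, ∫⁻ τ, ‖pgt M pol τ θ - gradient (perf M pol) θ‖ₑ ^ 2 ∂(trajLaw M pol θ)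
    ≤ ENNReal.ofReal (σ ^ 2)

/-- The variance of the importance weight `w(τ|θ',θ)`, `τ ∼ p(·|θ)`, is at most `W`, for all
`θ'` and `θ`. -/
def BoundedWeightVariance (M : MDP S A) (pol : PolicyFamily d S ν) (W : ℝ) : Prop :=
  ∀ θ' θ, evariance (fun τ => isWeight pol τ θ' θ) (trajLaw M pol θ) ≤ ENNReal.ofReal W

/-- The step size `η_t = k / (m + t)^{1/3}`. -/
def stepSize (k m : ℝ) (t : ℕ) : ℝ := k / (m + t) ^ (1 / 3 : ℝ)

/-- A run of IS-MBPG* with `T` iterations, parameters `k, m, c` and initial point `θ₁`, on a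
probability space `(Ω, μ)`. Here `τ t` is the single trajectory sampled in iteration `t`, `u t` is
the momentum gradient estimator, `θ t` is the iterate, `ζ` is the index of the output `θ_ζ`, and
`ℱ t` is the information available after iteration `t`. The momentum parameter of iteration
`t + 1` is `β_{t+1} = c η_t²`. -/
structure IsRun (M : MDP S A) (pol : PolicyFamily d S ν) (k m c : ℝ)
    (θ₁ : EuclideanSpace ℝ (Fin d)) (T : ℕ) {Ω : Type*} [mΩ : MeasurableSpace Ω]
    (μ : Measure Ω) (ℱ : Filtration ℕ mΩ) (τ : ℕ → Ω → Traj S A M.H)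
    (θ u : ℕ → Ω → EuclideanSpace ℝ (Fin d)) (ζ : Ω → ℕ) : Prop where
  /-- `τ_t` is known after iteration `t`. -/
  adapted : ∀ t, 1 ≤ t → t ≤ T → Measurable[ℱ t] (τ t)
  /-- Given the past, `τ_{t+1}` is sampled from `p(·|θ_{t+1})`. -/
  sample : ∀ t, t < T → ∀ B, MeasurableSet B →
    μ⟦τ (t + 1) ⁻¹' B | ℱ t⟧ =ᵐ[μ] fun ω => (trajLaw M pol (θ (t + 1) ω)).real B
  init : ∀ ω, θ 1 ω = θ₁
  u_one : ∀ ω, u 1 ω = pgt M pol (τ 1 ω) (θ 1 ω)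
  u_succ : ∀ t, 1 ≤ t → t < T → ∀ ω,
    u (t + 1) ω =
      (c * stepSize k m t ^ 2) • pgt M pol (τ (t + 1) ω) (θ (t + 1) ω)
      + (1 - c * stepSize k m t ^ 2) •
        (u t ω + pgt M pol (τ (t + 1) ω) (θ (t + 1) ω)
          - isWeight pol (τ (t + 1) ω) (θ t ω) (θ (t + 1) ω) •
              pgt M pol (τ (t + 1) ω) (θ t ω))
  θ_succ : ∀ t, 1 ≤ t → t ≤ T → ∀ ω, θ (t + 1) ω = θ t ω + stepSize k m t • u t ω
  /-- `ζ` is uniform on `{1, …, T}` and independent of the iterations. -/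
  measurable_ζ : Measurable ζ
  uniform_ζ : μ.map ζ = uniformOn (Set.Icc 1 T)
  indep_ζ : Indep (MeasurableSpace.comap ζ inferInstance) (ℱ T) μ

end PolicyGradient

end

/-! The estimator error e_t = u_t - ∇J(θ_t) is damped by 1 - β_{t+1} at each step, up to noise of
order β_{t+1}² σ² and a drift of order B² ‖θ_{t+1} - θ_t‖² = B² η_t² ‖u_t‖² in mean square. An
ascent step gains (η/2)‖∇J‖² + (η/8)‖u‖² and loses (η/2)‖e‖². In the potential E J(θ_t) - E‖e_t‖² /
(32 B² η_{t-1}) the drift cancels the gain in ‖u‖², the damping pays for the loss in ‖e‖², and what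
remains is noise of order η_t³ = k³/(m+t), whose sum is logarithmic. Telescoping
(`sum_stepSize_mul_le`) bounds ∑ η_t E‖∇J(θ_t)‖², and Cauchy–Schwarz
(`mean_le_of_sum_stepSize_mul_le`) converts this into the mean of E‖∇J(θ_t)‖.

The damping needs the correction g(τ|θ_{t+1}) - w g(τ|θ_t) to have mean ∇J(θ_{t+1}) - ∇J(θ_t).
Importance weighting changes the sampling law, and unbiasedness of g is the policy gradient theorem
(`BoundedScore.hasGradientAt_perf`): differentiate the trajectory density under the integral, then
discard the products of a reward with a later score, which have mean zero by causality.

The drift needs the correction to be small in L². Scores are Lipschitz, and E(w - 1)² is bounded by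
H² Mg² (W+1) ‖θ' - θ‖² (`BoundedWeightVariance.integral_sub_sq_le`). No second derivative of the
weight is involved: bounded scores give a local exponential bound on density ratios, and subdividing
the segment ever more finely turns it into a linear one (`pseudodist_le_of_le_exp_sub_one`). The
same device makes ∇J Lipschitz, with constant at most 3L/2 (`smoothness_le`).

Finally, θ_{t+1} is determined by ℱ_t, so τ_{t+1} can be integrated out with θ_t, θ_{t+1}, u_t
frozen (`lintegral_of_condExp_eq_kernel`). Deterministic one-step bounds thereby become recursions
between expectations. -/

namespace PolicyGradient

/-! ### Analytic preliminaries: density ratios, differentiation under the integral, a logarithmic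
sum -/

/-- Subdividing a segment turns a local exponential bound on a pseudo-distance into a linear one. -/
theorem pseudodist_le_of_le_exp_sub_one {E : Type*} [NormedAddCommGroup E] [NormedSpace ℝ E]
    {D : E → E → ENNReal} (hD : ∀ x y z, D x z ≤ D x y + D y z) {K a : ℝ}
    (h : ∀ x y, D x y ≤ ENNReal.ofReal (K * (Real.exp (a * ‖x - y‖) - 1))) (x y : E) :
    D x y ≤ ENNReal.ofReal (K * (a * ‖x - y‖)) := by
  have h0 : ∀ z, D z z = 0 := fun z => by simpa using h z z
  set r := a * ‖x - y‖ with hr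
  have key : ∀ n : ℕ, ∀ δ : ℝ, 0 ≤ δ → D x (x + (n * δ) • (y - x)) ≤
      n • ENNReal.ofReal (K * (Real.exp (r * δ) - 1)) := by
    intro n δ hδ
    induction n with
    | zero => simp [h0]
    | succ n ih =>
      refine (hD _ (x + (n * δ) • (y - x)) _).trans ?_
      rw [succ_nsmul]
      refine add_le_add ih ((h _ _).trans (le_of_eq ?_))
      congr 4
      have : x + (n * δ) • (y - x) - (x + ((n + 1 : ℕ) * δ) • (y - x)) = δ • (x - y) := by
        push_cast
        module
      rw [this, norm_smul, Real.norm_of_nonneg hδ, hr]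
      ring
  -- With N = n + 1 equal pieces the bound is K · N (exp(r/N) - 1), a difference quotient of t ↦
  -- exp(r t) at 0, hence tends to K r.
  have hlim : Tendsto (fun n : ℕ => ENNReal.ofReal
      (K * (((n + 1 : ℕ) : ℝ) * (Real.exp (r * ((n + 1 : ℕ) : ℝ)⁻¹) - 1)))) atTop
      (nhds (ENNReal.ofReal (K * r))) := by
    refine (ENNReal.continuous_ofReal.tendsto _).comp (Tendsto.const_mul K ?_)
    have hd : HasDerivAt (fun t : ℝ => Real.exp (r * t)) r 0 := by
      simpa using ((hasDerivAt_id (0 : ℝ)).const_mul r).exp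
    have ht : Tendsto (fun n : ℕ => ((n + 1 : ℕ) : ℝ)⁻¹) atTop (nhdsWithin 0 {0}ᶜ) := by
      refine tendsto_nhdsWithin_iff.2 ⟨?_, Eventually.of_forall fun n => ?_⟩
      · exact (tendsto_inv_atTop_nhds_zero_nat (𝕜 := ℝ)).comp (tendsto_add_atTop_nat 1)
      · simp only [Set.mem_compl_iff, Set.mem_singleton_iff, inv_eq_zero]
        positivity
    refine ((hasDerivAt_iff_tendsto_slope_zero.1 hd).comp ht).congr fun n => ?_
    simp
  refine ge_of_tendsto hlim (Eventually.of_forall fun n => ?_)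
  have hn : ((n + 1 : ℕ) : ℝ) ≠ 0 := by positivity
  have := key (n + 1) ((n + 1 : ℕ) : ℝ)⁻¹ (by positivity)
  rw [mul_inv_cancel₀ hn, one_smul, add_sub_cancel] at this
  refine this.trans (le_of_eq ?_)
  rw [← ENNReal.ofReal_nsmul, nsmul_eq_mul]
  ring_nf

/-- Exponentiating puts q between exp(-x) p and exp(x) p. The lower deviation 1 - exp(-x) is no
larger than the upper one exp(x) - 1, because cosh x ≥ 1. -/
theorem abs_sub_le_of_abs_log_sub_le {p q x : ℝ} (hp : 0 < p) (hq : 0 < q)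
    (h : |Real.log q - Real.log p| ≤ x) : |q - p| ≤ (Real.exp x - 1) * p := by
  obtain ⟨h1, h2⟩ := abs_le.1 h
  have e1 : q ≤ Real.exp x * p := by
    rw [← Real.log_le_log_iff hq (by positivity), Real.log_mul (by positivity) hp.ne',
      Real.log_exp]
    linarith
  have e2 : Real.exp (-x) * p ≤ q := by
    rw [← Real.log_le_log_iff (by positivity) hq, Real.log_mul (by positivity) hp.ne',
      Real.log_exp]
    linarith
  have e3 : 2 ≤ Real.exp x + Real.exp (-x) := by
    have := Real.one_le_cosh x
    rw [Real.cosh_eq] at this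
    linarith
  rw [abs_le]
  constructor <;> nlinarith

/-- Differentiation under the integral sign for a family of densities with bounded score. -/
theorem hasGradientAt_integral_mul_density {X E : Type*} [MeasurableSpace X]
    [NormedAddCommGroup E] [InnerProductSpace ℝ E] [CompleteSpace E] {μ : Measure X}
    {p : E → X → ℝ} {G : E → X → E} {F : X → ℝ} {K C : ℝ} (hp : ∀ θ x, 0 < p θ x)
    (hpi : ∀ θ, Integrable (p θ) μ)
    (hG : ∀ θ x, HasGradientAt (fun θ => Real.log (p θ x)) (G θ x) θ)
    (hGK : ∀ θ x, ‖G θ x‖ ≤ K) (hGm : ∀ θ, AEStronglyMeasurable (G θ) μ)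
    (hF : AEStronglyMeasurable F μ) (hFC : ∀ x, |F x| ≤ C) (θ : E) :
    HasGradientAt (fun θ => ∫ x, F x * p θ x ∂μ) (∫ x, (F x * p θ x) • G θ x ∂μ) θ := by
  -- A point of X is needed only to read off K ≥ 0 and C ≥ 0 from the bounds.
  rcases isEmpty_or_nonempty X with hX | ⟨⟨x₀⟩⟩
  · have : μ = 0 := Measure.eq_zero_of_isEmpty μ
    simpa [this] using hasGradientAt_const (x := θ) (c := (0 : ℝ))
  have hK : 0 ≤ K := (norm_nonneg _).trans (hGK θ x₀)
  have hC : 0 ≤ C := (abs_nonneg _).trans (hFC x₀)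
  have hlog : ∀ x θ θ', |Real.log (p θ' x) - Real.log (p θ x)| ≤ K * ‖θ' - θ‖ := by
    intro x θ θ'
    have := Convex.norm_image_sub_le_of_norm_hasFDerivWithin_le (𝕜 := ℝ) (C := K)
      (f := fun θ => Real.log (p θ x)) (s := Set.univ) (x := θ) (y := θ')
      (fun z _ => (hasGradientAt_iff_hasFDerivAt.1 (hG z x)).hasFDerivWithinAt)
      (fun z _ => by simpa using hGK z x) convex_univ trivial trivial
    simpa using this
  -- The log-derivative identity ∇p = p ∇log p, obtained by differentiating p = exp(log p).
  have hpd : ∀ θ x, HasGradientAt (fun θ => p θ x) (p θ x • G θ x) θ := by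
    intro θ x
    have := (hasGradientAt_iff_hasFDerivAt.1 (hG θ x)).exp
    rw [hasGradientAt_iff_hasFDerivAt]
    simp only [Real.exp_log (hp _ _)] at this
    simpa using this
  rw [hasGradientAt_iff_hasFDerivAt]
  have hint : Integrable (fun x => (F x * p θ x) • G θ x) μ := by
    refine ((hpi θ).const_mul (C * K)).mono ((hF.mul (hpi θ).1).smul (hGm θ))
      (Eventually.of_forall fun x => ?_)
    rw [norm_smul, norm_mul, norm_mul, norm_mul, Real.norm_eq_abs (F x), Real.norm_of_nonneg hC,
      Real.norm_of_nonneg hK]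
    calc |F x| * ‖p θ x‖ * ‖G θ x‖ ≤ C * ‖p θ x‖ * K := by
          gcongr
          exacts [hFC x, hGK θ x]
      _ = _ := by ring
  have hdual : (InnerProductSpace.toDual ℝ E) (∫ x, (F x * p θ x) • G θ x ∂μ) =
      ∫ x, (InnerProductSpace.toDual ℝ E) ((F x * p θ x) • G θ x) ∂μ :=
    ((innerSL ℝ).integral_comp_comm hint).symm
  rw [hdual]
  -- On the unit ball around θ the density is at most exp(K) times its value at θ, so C K exp(K) p_θ
  -- dominates every derivative there.
  refine hasFDerivAt_integral_of_dominated_of_fderiv_le (Metric.ball_mem_nhds θ one_pos)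
    (F := fun θ x => F x * p θ x)
    (F' := fun θ x => (InnerProductSpace.toDual ℝ E) ((F x * p θ x) • G θ x))
    (bound := fun x => C * K * Real.exp K * p θ x)
    (Eventually.of_forall fun θ => hF.mul (hpi θ).1) ?_ ?_ ?_ ?_ ?_
  · refine ((hpi θ).const_mul C).mono (hF.mul (hpi θ).1) (Eventually.of_forall fun x => ?_)
    rw [norm_mul, norm_mul, Real.norm_of_nonneg hC]
    gcongr
    exact hFC x
  · exact (innerSL ℝ (E := E)).continuous.comp_aestronglyMeasurable hint.1
  · refine Eventually.of_forall fun x z hz => ?_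
    have hz1 : ‖z - θ‖ ≤ 1 := by simpa [dist_eq_norm] using (Metric.mem_ball.1 hz).le
    have hle : p z x ≤ Real.exp K * p θ x := by
      have := abs_sub_le_of_abs_log_sub_le (hp θ x) (hp z x)
        ((hlog x θ z).trans (mul_le_of_le_one_right hK hz1))
      have := (abs_le.1 this).2
      linarith
    rw [LinearIsometryEquiv.norm_map, norm_smul, norm_mul, Real.norm_of_nonneg (hp z x).le]
    calc ‖F x‖ * p z x * ‖G z x‖ ≤ C * (Real.exp K * p θ x) * K := by
          have := hp z x
          have := hp θ x
          gcongr
          exacts [hFC x, hGK z x]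
      _ = _ := by ring
  · exact (hpi θ).const_mul _
  · refine Eventually.of_forall fun x z _ => ?_
    have := (hasGradientAt_iff_hasFDerivAt.1 (hpd z x)).const_mul (F x)
    simpa [smul_smul] using this

/-- Each term is at most log(m+t) - log(m+t-1), and the sum telescopes to log((m+T)/m). -/
theorem sum_inv_le_log {m : ℝ} (hm : 2 ≤ m) (T : ℕ) :
    ∑ t ∈ Finset.Icc 1 T, 1 / (m + t) ≤ Real.log (T + 2) := by
  have h : ∀ T : ℕ, ∑ t ∈ Finset.Icc 1 T, 1 / (m + t) ≤ Real.log (m + T) - Real.log m := by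
    intro T
    induction T with
    | zero => simp
    | succ n ih =>
      rw [Finset.sum_Icc_succ_top (by omega)]
      have hx : (0 : ℝ) < m + n := by positivity
      have hy : (0 : ℝ) < m + (n + 1 : ℕ) := by positivity
      have := Real.log_le_sub_one_of_pos (div_pos hx hy)
      rw [Real.log_div hx.ne' hy.ne'] at this
      have e : (m + n) / (m + (n + 1 : ℕ)) - 1 = -(1 / (m + (n + 1 : ℕ))) := by
        field_simp
        push_cast
        ring
      linarith
  refine (h T).trans ?_
  have hm0 : 0 < m := by linarith
  rw [← Real.log_div (by positivity) hm0.ne']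
  refine Real.log_le_log (by positivity) ?_
  rw [div_le_iff₀ hm0]
  have : (0 : ℝ) ≤ T := by positivity
  nlinarith

/-! ### The step sizes -/

section StepSize

theorem stepSize_pos {k m : ℝ} (hk : 0 < k) (hm : 2 ≤ m) (t : ℕ) : 0 < stepSize k m t := by
  unfold stepSize
  positivity

theorem stepSize_cube {k m : ℝ} (hm : 2 ≤ m) (t : ℕ) :
    stepSize k m t ^ 3 = k ^ 3 * (1 / (m + t)) := by
  have hm0 : 0 ≤ m + t := by positivity
  rw [stepSize, div_pow, ← Real.rpow_natCast (_ ^ _), ← Real.rpow_mul hm0]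
  norm_num
  ring

theorem stepSize_le {k m x : ℝ} (hk : 0 < k) (hm : 2 ≤ m) (h : (k * x) ^ 3 ≤ m)
    (t : ℕ) : stepSize k m t * x ≤ 1 := by
  have h0 : 0 < stepSize k m t := stepSize_pos hk hm t
  have h3 : (stepSize k m t * x) ^ 3 ≤ 1 := by
    rw [mul_pow, stepSize_cube hm]
    have : (0 : ℝ) ≤ t := by positivity
    rw [mul_pow] at h
    have hmt : 0 < m + t := by linarith
    rw [show k ^ 3 * (1 / (m + t)) * x ^ 3 = (k ^ 3 * x ^ 3) / (m + t) by ring, div_le_one hmt]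
    linarith
  by_contra! hlt
  exact absurd h3 (not_le.2 (one_lt_pow₀ hlt (by norm_num)))

theorem stepSize_anti {k m : ℝ} (hk : 0 < k) (hm : 2 ≤ m) {s t : ℕ} (hst : s ≤ t) :
    stepSize k m t ≤ stepSize k m s := by
  unfold stepSize
  gcongr

/-- Up to the factor 1/k this is an increment y - x of the cube root, where y³ - x³ = 1. Convexity
of the cube gives 3x²(y - x) ≤ 1. Since y³ ≤ 2x³ and y ≥ 2Lk, one has k L y ≤ y²/2 ≤ x², which
trades x² for a multiple of y, that is, of 1/η_{t+1}. -/
theorem inv_stepSize_sub_le {k m L : ℝ} (hk : 0 < k) (hL : 0 < L) (hm : 2 ≤ m)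
    (h : (2 * L * k) ^ 3 ≤ m) (t : ℕ) :
    1 / stepSize k m (t + 1) - 1 / stepSize k m t ≤
      1 / (3 * k ^ 3 * L) * stepSize k m (t + 1) := by
  set x := (m + t) ^ (1 / 3 : ℝ) with hx
  set y := (m + (t + 1 : ℕ)) ^ (1 / 3 : ℝ) with hy
  have hmt : 0 ≤ m + t := by positivity
  have hmt' : 0 ≤ m + (t + 1 : ℕ) := by positivity
  have hx0 : 0 < x := by positivity
  have hy0 : 0 < y := by positivity
  have hx3 : x ^ 3 = m + t := by
    rw [hx, ← Real.rpow_natCast (_ ^ _), ← Real.rpow_mul hmt]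
    norm_num
  have hy3 : y ^ 3 = m + t + 1 := by
    rw [hy, ← Real.rpow_natCast (_ ^ _), ← Real.rpow_mul hmt']
    push_cast
    norm_num
    ring
  have hxy : x ≤ y := by
    rw [hx, hy]
    gcongr
    simp
  have ht : (0 : ℝ) ≤ t := by positivity
  have hLy : 2 * L * k ≤ y := by
    refine le_of_pow_le_pow_left₀ (n := 3) (by norm_num) hy0.le ?_
    linarith
  have hyx : y ^ 2 ≤ 2 * x ^ 2 := by
    have : y ^ 3 ≤ 2 * x ^ 3 := by linarith
    nlinarith [sq_nonneg x]
  rw [stepSize, stepSize, ← hx, ← hy]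
  have e : 1 / (k / y) - 1 / (k / x) = (y - x) / k := by
    field_simp
  have e2 : 1 / (3 * k ^ 3 * L) * (k / y) = 1 / (3 * k ^ 2 * L * y) := by
    field_simp
  rw [e, e2, div_le_div_iff₀ hk (by positivity)]
  have h1 : (y - x) * (3 * x ^ 2) ≤ 1 := by
    have : 0 ≤ (y - x) ^ 2 * (y + 2 * x) := by positivity
    linarith
  have h2 : k * L * y ≤ x ^ 2 := by nlinarith
  have h3 : (y - x) * (3 * (k * L * y)) ≤ (y - x) * (3 * x ^ 2) := by
    have := sub_nonneg.2 hxy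
    gcongr
  nlinarith

/-- The two cubic lower bounds on m say η · 2L ≤ 1 and η · c/(2L) ≤ 1; their product is the momentum
parameter. -/
theorem mul_stepSize_sq_le_one {k m c L : ℝ} (hk : 0 < k) (hL : 0 < L) (hc : 0 ≤ c)
    (hm : 2 ≤ m) (hm1 : (2 * L * k) ^ 3 ≤ m) (hm2 : (c * k / (2 * L)) ^ 3 ≤ m) (t : ℕ) :
    c * stepSize k m t ^ 2 ≤ 1 := by
  have h1 := stepSize_le (x := 2 * L) hk hm (by convert hm1 using 1; ring) t
  have h2 := stepSize_le (x := c / (2 * L)) hk hm (by convert hm2 using 1; ring) t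
  have h3 := stepSize_pos hk hm t
  calc c * stepSize k m t ^ 2 =
        (stepSize k m t * (2 * L)) * (stepSize k m t * (c / (2 * L))) := by field_simp
    _ ≤ 1 * 1 := by gcongr
    _ = 1 := by ring

end StepSize

/-! ### The potential function -/

/-- The potential-function argument of momentum-based variance reduction, for the sequences
`j t = E J(θ_t)`, `n t = E‖∇J(θ_t)‖²`, `b t = E‖u_t‖²` and `a t = E‖u_t - ∇J(θ_t)‖²`. -/
theorem sum_stepSize_mul_le {k m c L B σ Js j₁ : ℝ} {T : ℕ} {a b n j : ℕ → ℝ} (hk : 0 < k)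
    (hL : 0 < L) (hB : 0 < B) (hc : c = 1 / (3 * k ^ 3 * L) + 104 * B ^ 2) (hm : 2 ≤ m)
    (hm1 : (2 * L * k) ^ 3 ≤ m) (hm2 : (c * k / (2 * L)) ^ 3 ≤ m) (ha : ∀ t, 0 ≤ a t)
    (ha1 : a 1 ≤ σ ^ 2)
    (hrec : ∀ t, 1 ≤ t → t ≤ T → a (t + 1) ≤ (1 - c * stepSize k m t ^ 2) ^ 2 * a t +
      2 * (c * stepSize k m t ^ 2) ^ 2 * σ ^ 2 + 4 * B ^ 2 * stepSize k m t ^ 2 * b t)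
    (hasc : ∀ t, 1 ≤ t → t ≤ T → j t + stepSize k m t / 2 * n t + stepSize k m t / 8 * b t -
      stepSize k m t / 2 * a t ≤ j (t + 1))
    (hj1 : j 1 = j₁) (hj : j (T + 1) ≤ Js) :
    ∑ t ∈ Finset.Icc 1 T, stepSize k m t * n t ≤ 2 * (Js - j₁) +
      m ^ (1 / 3 : ℝ) / (16 * B ^ 2 * k) * σ ^ 2 +
      c ^ 2 * k ^ 3 * σ ^ 2 / (8 * B ^ 2) * Real.log (T + 2) := by
  have hc0 : 0 < c := by rw [hc]; positivity
  have hη : ∀ t, 0 < stepSize k m t := stepSize_pos hk hm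
  have hβ := mul_stepSize_sq_le_one hk hL hc0.le hm hm1 hm2
  -- The potential is j t - a t / (32 B² η_{t-1}). The weight 1/(32 B²) turns the drift 4 B² η b
  -- into η b / 8, exactly the gain in `hasc`. The index starts at η_0, which the algorithm itself
  -- never uses.
  have key : ∀ s, s ≤ T → ∑ t ∈ Finset.Icc 1 s, stepSize k m t / 2 * n t ≤
      (j (s + 1) - 1 / (32 * B ^ 2) * (a (s + 1) / stepSize k m s)) -
      (j 1 - 1 / (32 * B ^ 2) * (a 1 / stepSize k m 0)) +
      c ^ 2 * σ ^ 2 / (16 * B ^ 2) * ∑ t ∈ Finset.Icc 1 s, stepSize k m t ^ 3 := by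
    intro s hs
    induction s with
    | zero => simp
    | succ s ih =>
      have ih := ih (by omega)
      rw [Finset.sum_Icc_succ_top (by omega), Finset.sum_Icc_succ_top (by omega)]
      have h1 := hasc (s + 1) (by omega) hs
      have h2 := hrec (s + 1) (by omega) hs
      have h3 := inv_stepSize_sub_le hk hL hm hm1 s
      have h4 := hβ (s + 1)
      set η := stepSize k m (s + 1) with hηd
      set η' := stepSize k m s with hηd'
      have hη0 : 0 < η := hη _
      have hη0' : 0 < η' := hη _
      have ha0 := ha (s + 1)
      have hsq : (1 - c * η ^ 2) ^ 2 ≤ 1 - c * η ^ 2 := by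
        have : 0 ≤ c * η ^ 2 := by positivity
        nlinarith
      have h5 : a (s + 1 + 1) ≤ (1 - c * η ^ 2) * a (s + 1) +
          2 * (c * η ^ 2) ^ 2 * σ ^ 2 + 4 * B ^ 2 * η ^ 2 * b (s + 1) := by
        nlinarith [mul_le_mul_of_nonneg_right hsq ha0]
      have h6 : a (s + 1 + 1) / η - a (s + 1) / η' ≤ -(104 * B ^ 2 * η) * a (s + 1) +
          2 * c ^ 2 * η ^ 3 * σ ^ 2 + 4 * B ^ 2 * η * b (s + 1) := by
        have h7 : a (s + 1 + 1) / η ≤ (1 / η - c * η) * a (s + 1) +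
          2 * c ^ 2 * η ^ 3 * σ ^ 2 + 4 * B ^ 2 * η * b (s + 1) := by
          rw [div_le_iff₀ hη0]
          refine h5.trans (le_of_eq ?_)
          field_simp
        -- The growth of 1/η is paid for by the summand 1/(3k³L) of c; the summand 104 B² is left
        -- over as damping.
        have h8 : (1 / η - 1 / η') * a (s + 1) ≤ 1 / (3 * k ^ 3 * L) * η * a (s + 1) := by
          gcongr
        have h9 : c * η * a (s + 1) = 1 / (3 * k ^ 3 * L) * η * a (s + 1) +
          104 * B ^ 2 * η * a (s + 1) := by
          rw [hc]; ring
        have h10 : a (s + 1) / η' = 1 / η' * a (s + 1) := by ring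
        rw [h10]
        linarith
      -- 104/32 = 13/4, which exceeds the loss 1/2 of an ascent step, so all terms in a(s+1) can be
      -- dropped afterwards.
      have h7 : 1 / (32 * B ^ 2) * (a (s + 1 + 1) / η - a (s + 1) / η') ≤
          -(13 / 4 * η) * a (s + 1) + c ^ 2 * σ ^ 2 / (16 * B ^ 2) * η ^ 3 +
          η / 8 * b (s + 1) := by
        refine (mul_le_mul_of_nonneg_left h6 (by positivity)).trans (le_of_eq ?_)
        field_simp
        ring
      have h8 : 0 ≤ η * a (s + 1) := by positivity
      linarith
  have h := key T le_rfl
  have hsum : ∑ t ∈ Finset.Icc 1 T, stepSize k m t ^ 3 ≤ k ^ 3 * Real.log (T + 2) := by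
    simp_rw [stepSize_cube hm, ← Finset.mul_sum]
    gcongr
    exact sum_inv_le_log hm T
  -- Here 1/η_0 = m^(1/3)/k, the origin of the factor m^(1/3) in Γ.
  have h0 : 1 / (32 * B ^ 2) * (a 1 / stepSize k m 0) ≤
      m ^ (1 / 3 : ℝ) / (32 * B ^ 2 * k) * σ ^ 2 := by
    have : a 1 / stepSize k m 0 ≤ σ ^ 2 / stepSize k m 0 := by
      have := hη 0
      gcongr
    refine (mul_le_mul_of_nonneg_left this (by positivity)).trans (le_of_eq ?_)
    simp only [stepSize, Nat.cast_zero, add_zero]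
    have : (0 : ℝ) < m ^ (1 / 3 : ℝ) := by positivity
    field_simp
  have h1 : 0 ≤ 1 / (32 * B ^ 2) * (a (T + 1) / stepSize k m T) := by
    have := hη T
    have := ha (T + 1)
    positivity
  have h2 : c ^ 2 * σ ^ 2 / (16 * B ^ 2) * ∑ t ∈ Finset.Icc 1 T, stepSize k m t ^ 3 ≤
      c ^ 2 * σ ^ 2 / (16 * B ^ 2) * (k ^ 3 * Real.log (T + 2)) := by
    gcongr
  have h3 : ∑ t ∈ Finset.Icc 1 T, stepSize k m t * n t =
      2 * ∑ t ∈ Finset.Icc 1 T, stepSize k m t / 2 * n t := by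
    rw [Finset.mul_sum]
    exact Finset.sum_congr rfl fun t _ => by ring
  rw [h3]
  have e1 : m ^ (1 / 3 : ℝ) / (16 * B ^ 2 * k) * σ ^ 2 =
    2 * (m ^ (1 / 3 : ℝ) / (32 * B ^ 2 * k) * σ ^ 2) := by
    field_simp
    ring
  have e2 : c ^ 2 * k ^ 3 * σ ^ 2 / (8 * B ^ 2) * Real.log (T + 2) =
    2 * (c ^ 2 * σ ^ 2 / (16 * B ^ 2) * (k ^ 3 * Real.log (T + 2))) := by
    field_simp
    ring
  rw [e1, e2]
  linarith

end PolicyGradient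

namespace PolicyGradient

/-! ### Measurability of gradients in a parameter -/

section Measurability

/-- Each coordinate is a pointwise limit of difference quotients with increments 1/n, which are
measurable. -/
theorem measurable_gradient_of_differentiable {X : Type*} [MeasurableSpace X] {d : ℕ}
    {f : EuclideanSpace ℝ (Fin d) → X → ℝ} (hf : ∀ θ, Measurable (f θ))
    (hd : ∀ x, Differentiable ℝ fun θ => f θ x) (θ : EuclideanSpace ℝ (Fin d)) :
    Measurable fun x => gradient (fun θ => f θ x) θ := by
  have hi : ∀ i, Measurable fun x => (gradient (fun θ => f θ x) θ) i := by
    intro i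
    have h : ∀ x, Tendsto (fun n : ℕ => (n : ℝ) •
        (f (θ + (n : ℝ)⁻¹ • EuclideanSpace.single i 1) x - f θ x)) atTop
        (nhds ((gradient (fun θ => f θ x) θ) i)) := by
      intro x
      have h1 := ((hd x θ).hasFDerivAt.lim_real (EuclideanSpace.single i 1)).comp
        tendsto_natCast_atTop_atTop
      rw [← inner_gradient_left, EuclideanSpace.inner_single_right] at h1
      simpa [Function.comp_def] using h1
    refine measurable_of_tendsto_metrizable (f := fun (n : ℕ) x => (n : ℝ) •
      (f (θ + (n : ℝ)⁻¹ • EuclideanSpace.single i 1) x - f θ x)) (fun n => ?_)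
      (tendsto_pi_nhds.2 h)
    exact ((hf _).sub (hf _)).const_smul (n : ℝ)
  exact (WithLp.measurable_toLp 2 _).comp (measurable_pi_iff.2 hi)

end Measurability

/-! ### Densities and scores of trajectories -/

variable {S A : Type*} [MeasurableSpace S] [MeasurableSpace A] {d : ℕ} {ν : Measure A}

/-- The density of a trajectory with respect to the reference measure. -/
noncomputable def pathDens (pol : PolicyFamily d S ν) {n : ℕ} (θ : EuclideanSpace ℝ (Fin d))
    (τ : Traj S A n) : ℝ :=
  ∏ h : Fin n, pol.dens θ (τ h).1 (τ h).2

/-- The score of a whole trajectory. -/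
noncomputable def pathScore (pol : PolicyFamily d S ν) {n : ℕ} (θ : EuclideanSpace ℝ (Fin d))
    (τ : Traj S A n) : EuclideanSpace ℝ (Fin d) :=
  ∑ h : Fin n, score pol (τ h).1 (τ h).2 θ

theorem pathDens_pos (pol : PolicyFamily d S ν) {n : ℕ} (θ : EuclideanSpace ℝ (Fin d))
    (τ : Traj S A n) : 0 < pathDens pol θ τ :=
  Finset.prod_pos fun _ _ => pol.dens_pos _ _ _

theorem measurable_pathDens (pol : PolicyFamily d S ν) {n : ℕ} (θ : EuclideanSpace ℝ (Fin d)) :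
    Measurable (pathDens pol θ : Traj S A n → ℝ) :=
  Finset.measurable_prod _ fun h _ => (pol.measurable_dens θ).comp (measurable_pi_apply h)

theorem pathDens_cons (pol : PolicyFamily d S ν) {n : ℕ} (θ : EuclideanSpace ℝ (Fin d))
    (x : S × A) (τ : Traj S A n) :
    pathDens pol θ (Fin.cons x τ : Traj S A (n + 1)) = pol.dens θ x.1 x.2 * pathDens pol θ τ := by
  simp [pathDens, Fin.prod_univ_succ]

theorem measurable_cons (n : ℕ) :
    Measurable fun x : (S × A) × Traj S A n => (Fin.cons x.1 x.2 : Traj S A (n + 1)) := by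
  refine measurable_pi_iff.2 fun i => ?_
  refine Fin.cases ?_ (fun i => ?_) i
  · simpa using measurable_fst
  · simp only [Fin.cons_succ]
    exact (measurable_pi_apply i).comp measurable_snd

section Score

variable {pol : PolicyFamily d S ν} {Mg Mh : ℝ}

theorem BoundedScore.hasGradientAt_log (h : BoundedScore pol Mg Mh) (s : S) (a : A)
    (θ : EuclideanSpace ℝ (Fin d)) :
    HasGradientAt (fun θ => Real.log (pol.dens θ s a)) (score pol s a θ) θ :=
  (h.differentiable_log s a θ).hasGradientAt

theorem BoundedScore.continuous_dens (h : BoundedScore pol Mg Mh) (s : S) (a : A) :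
    Continuous fun θ => pol.dens θ s a := by
  have := (h.differentiable_log s a).continuous.rexp
  simpa only [Real.exp_log (pol.dens_pos _ _ _)] using this

theorem BoundedScore.measurable_score (h : BoundedScore pol Mg Mh)
    (θ : EuclideanSpace ℝ (Fin d)) : Measurable fun x : S × A => score pol x.1 x.2 θ :=
  measurable_gradient_of_differentiable
    (f := fun θ (x : S × A) => Real.log (pol.dens θ x.1 x.2))
    (fun θ => (pol.measurable_dens θ).log) (fun x => h.differentiable_log x.1 x.2) θ

/-- Continuity in θ together with measurability in (s, a) gives joint measurability. This is needed
because the score is later evaluated at random iterates. -/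
theorem BoundedScore.measurable_uncurry_score (h : BoundedScore pol Mg Mh) :
    Measurable fun x : EuclideanSpace ℝ (Fin d) × (S × A) => score pol x.2.1 x.2.2 x.1 :=
  measurable_uncurry_of_continuous_of_measurable
    (u := fun θ (x : S × A) => score pol x.1 x.2 θ)
    (fun x => (h.differentiable_score x.1 x.2).continuous) h.measurable_score

theorem BoundedScore.measurable_uncurry_dens (h : BoundedScore pol Mg Mh) :
    Measurable fun x : EuclideanSpace ℝ (Fin d) × (S × A) => pol.dens x.1 x.2.1 x.2.2 :=
  measurable_uncurry_of_continuous_of_measurable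
    (u := fun θ (x : S × A) => pol.dens θ x.1 x.2)
    (fun x => h.continuous_dens x.1 x.2) pol.measurable_dens

theorem BoundedScore.measurable_uncurry_pathDens (h : BoundedScore pol Mg Mh) (n : ℕ) :
    Measurable fun x : EuclideanSpace ℝ (Fin d) × Traj S A n => pathDens pol x.1 x.2 :=
  Finset.measurable_prod _ fun i _ => h.measurable_uncurry_dens.comp
    (measurable_fst.prodMk ((measurable_pi_apply i).comp measurable_snd))

theorem BoundedScore.measurable_pathScore (h : BoundedScore pol Mg Mh) {n : ℕ}
    (θ : EuclideanSpace ℝ (Fin d)) : Measurable (pathScore pol θ : Traj S A n → _) :=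
  Finset.measurable_sum _ fun i _ => (h.measurable_score θ).comp (measurable_pi_apply i)

theorem BoundedScore.norm_pathScore_le (h : BoundedScore pol Mg Mh) {n : ℕ}
    (θ : EuclideanSpace ℝ (Fin d)) (τ : Traj S A n) : ‖pathScore pol θ τ‖ ≤ n * Mg := by
  refine (norm_sum_le _ _).trans ((Finset.sum_le_sum fun i _ => h.norm_score_le _ _ _).trans ?_)
  simp

theorem BoundedScore.hasGradientAt_log_pathDens (h : BoundedScore pol Mg Mh) {n : ℕ}
    (θ : EuclideanSpace ℝ (Fin d)) (τ : Traj S A n) :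
    HasGradientAt (fun θ => Real.log (pathDens pol θ τ)) (pathScore pol θ τ) θ := by
  have h1 : (fun θ => Real.log (pathDens pol θ τ)) =
      fun θ => ∑ i : Fin n, Real.log (pol.dens θ (τ i).1 (τ i).2) := by
    funext θ
    exact Real.log_prod fun i _ => (pol.dens_pos _ _ _).ne'
  rw [h1, hasGradientAt_iff_hasFDerivAt, pathScore, map_sum]
  exact HasFDerivAt.fun_sum fun i _ =>
    hasGradientAt_iff_hasFDerivAt.1 (h.hasGradientAt_log (τ i).1 (τ i).2 θ)

theorem BoundedScore.abs_log_pathDens_sub_le (h : BoundedScore pol Mg Mh) {n : ℕ}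
    (θ θ' : EuclideanSpace ℝ (Fin d)) (τ : Traj S A n) :
    |Real.log (pathDens pol θ' τ) - Real.log (pathDens pol θ τ)| ≤ n * Mg * ‖θ' - θ‖ := by
  have := Convex.norm_image_sub_le_of_norm_hasFDerivWithin_le (𝕜 := ℝ) (C := n * Mg)
    (f := fun θ => Real.log (pathDens pol θ τ)) (s := Set.univ) (x := θ) (y := θ')
    (fun z _ => (hasGradientAt_iff_hasFDerivAt.1
      (h.hasGradientAt_log_pathDens z τ)).hasFDerivWithinAt)
    (fun z _ => by simpa using h.norm_pathScore_le z τ) convex_univ trivial trivial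
  simpa using this

theorem BoundedScore.norm_score_sub_le (h : BoundedScore pol Mg Mh) (s : S) (a : A)
    (θ θ' : EuclideanSpace ℝ (Fin d)) :
    ‖score pol s a θ' - score pol s a θ‖ ≤ Mh * ‖θ' - θ‖ :=
  Convex.norm_image_sub_le_of_norm_fderiv_le (𝕜 := ℝ) (f := score pol s a) (s := Set.univ)
    (fun z _ => h.differentiable_score s a z) (fun z _ => h.norm_hessian_le s a z)
    convex_univ trivial trivial

end Score

/-! ### Trajectories as Markov chains and causality of scores -/

section Kernels

/-- The policy `π_θ` as a Markov kernel from states to actions. -/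
noncomputable def policyKernel (pol : PolicyFamily d S ν) [SFinite ν]
    (θ : EuclideanSpace ℝ (Fin d)) : Kernel S A :=
  (Kernel.const S ν).withDensity fun s a => ENNReal.ofReal (pol.dens θ s a)

theorem measurable_ofReal_dens (pol : PolicyFamily d S ν) (θ : EuclideanSpace ℝ (Fin d)) :
    Measurable (Function.uncurry fun s a => ENNReal.ofReal (pol.dens θ s a)) :=
  (pol.measurable_dens θ).ennreal_ofReal

theorem policyKernel_apply (pol : PolicyFamily d S ν) [SFinite ν] (θ : EuclideanSpace ℝ (Fin d))
    (s : S) :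
    policyKernel pol θ s = ν.withDensity fun a => ENNReal.ofReal (pol.dens θ s a) := by
  rw [policyKernel, Kernel.withDensity_apply _ (measurable_ofReal_dens pol θ), Kernel.const_apply]

instance isMarkovKernel_policyKernel (pol : PolicyFamily d S ν) [SFinite ν]
    (θ : EuclideanSpace ℝ (Fin d)) : IsMarkovKernel (policyKernel pol θ) := by
  refine ⟨fun s => ⟨?_⟩⟩
  rw [policyKernel_apply, withDensity_apply _ MeasurableSet.univ, Measure.restrict_univ,
    pol.lintegral_dens]

/-- The law of a trajectory of `n` steps from a given initial state under the policy `π_θ`. -/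
noncomputable def pathKernel (P : Kernel (S × A) S) (pol : PolicyFamily d S ν) [SFinite ν]
    (θ : EuclideanSpace ℝ (Fin d)) : (n : ℕ) → Kernel S (Traj S A n)
  | 0 => Kernel.const S (Measure.dirac Fin.elim0)
  | n + 1 =>
      ((Kernel.id ×ₖ policyKernel pol θ) ⊗ₖ Kernel.prodMkLeft S (pathKernel P pol θ n ∘ₖ P)).map
        (fun x : (S × A) × Traj S A n => (Fin.cons x.1 x.2 : Traj S A (n + 1)))

variable (P : Kernel (S × A) S) [IsMarkovKernel P] (pol : PolicyFamily d S ν) [SFinite ν]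
  (θ : EuclideanSpace ℝ (Fin d))

instance isMarkovKernel_pathKernel (n : ℕ) : IsMarkovKernel (pathKernel P pol θ n) := by
  induction n with
  | zero => unfold pathKernel; infer_instance
  | succ n ih =>
    unfold pathKernel
    exact Kernel.IsMarkovKernel.map _ (measurable_cons n)

theorem lintegral_pathKernel_succ {n : ℕ} (s : S) {f : Traj S A (n + 1) → ENNReal}
    (hf : Measurable f) :
    ∫⁻ τ, f τ ∂(pathKernel P pol θ (n + 1) s) = ∫⁻ a, ∫⁻ s', ∫⁻ x, f (Fin.cons (s, a) x)
      ∂(pathKernel P pol θ n s') ∂(P (s, a)) ∂(policyKernel pol θ s) := by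
  have hfc : Measurable fun x : (S × A) × Traj S A n => f (Fin.cons x.1 x.2) :=
    hf.comp (measurable_cons n)
  rw [pathKernel, Kernel.lintegral_map _ (measurable_cons n) _ hf,
    Kernel.lintegral_compProd _ _ _ hfc, Kernel.lintegral_id_prod]
  · refine lintegral_congr fun a => ?_
    rw [Kernel.prodMkLeft_apply, Kernel.lintegral_comp]
    exact hfc.comp measurable_prodMk_left
  · exact hfc.lintegral_kernel_prod_right'' (η := Kernel.prodMkLeft S (pathKernel P pol θ n ∘ₖ P))

theorem lintegral_baseKernel_succ {n : ℕ} (s : S) {f : Traj S A (n + 1) → ENNReal}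
    (hf : Measurable f) :
    ∫⁻ τ, f τ ∂(baseKernel P ν (n + 1) s) = ∫⁻ a, ∫⁻ s', ∫⁻ x, f (Fin.cons (s, a) x)
      ∂(baseKernel P ν n s') ∂(P (s, a)) ∂ν := by
  have hfc : Measurable fun x : (S × A) × Traj S A n => f (Fin.cons x.1 x.2) :=
    hf.comp (measurable_cons n)
  rw [baseKernel, Kernel.lintegral_map _ (measurable_cons n) _ hf,
    Kernel.lintegral_compProd _ _ _ hfc, Kernel.lintegral_id_prod]
  · rw [Kernel.const_apply]
    refine lintegral_congr fun a => ?_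
    rw [Kernel.prodMkLeft_apply, Kernel.lintegral_comp]
    exact hfc.comp measurable_prodMk_left
  · exact hfc.lintegral_kernel_prod_right'' (η := Kernel.prodMkLeft S (baseKernel P ν n ∘ₖ P))

/-- Peeling off the first step splits one factor from the product density, and that factor is the
density of the policy kernel. This identifies the sequentially generated law with the one given by a
density, so that both normalization and conditioning on the first step become available. -/
theorem lintegral_pathKernel (n : ℕ) (s : S) {f : Traj S A n → ENNReal} (hf : Measurable f) :
    ∫⁻ τ, f τ ∂(pathKernel P pol θ n s) =
      ∫⁻ τ, ENNReal.ofReal (pathDens pol θ τ) * f τ ∂(baseKernel P ν n s) := by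
  induction n generalizing s with
  | zero =>
    simp only [pathKernel, baseKernel, Kernel.const_apply]
    refine lintegral_congr fun τ => ?_
    simp [pathDens]
  | succ n ih =>
    have hfc : Measurable fun x : (S × A) × Traj S A n => f (Fin.cons x.1 x.2) :=
      hf.comp (measurable_cons n)
    have hpf : Measurable fun τ : Traj S A (n + 1) => ENNReal.ofReal (pathDens pol θ τ) * f τ :=
      (measurable_pathDens pol θ).ennreal_ofReal.mul hf
    have hd : Measurable fun a => ENNReal.ofReal (pol.dens θ s a) :=
      (measurable_ofReal_dens pol θ).comp measurable_prodMk_left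
    rw [lintegral_pathKernel_succ P pol θ s hf, lintegral_baseKernel_succ P s hpf,
      policyKernel_apply, lintegral_withDensity_eq_lintegral_mul₀ hd.aemeasurable]
    · refine lintegral_congr fun a => ?_
      simp only [Pi.mul_apply]
      rw [← lintegral_const_mul' _ _ ENNReal.ofReal_ne_top]
      refine lintegral_congr fun s' => ?_
      have hm : Measurable fun x : Traj S A n => f (Fin.cons (s, a) x) :=
        hfc.comp measurable_prodMk_left
      rw [ih s' hm, ← lintegral_const_mul' _ _ ENNReal.ofReal_ne_top]
      refine lintegral_congr fun x => ?_
      rw [pathDens_cons, ENNReal.ofReal_mul (pol.dens_pos _ _ _).le, mul_assoc]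
    · refine Measurable.aemeasurable ?_
      have h1 : Measurable fun x : S × (S × A) =>
          ∫⁻ y, f (Fin.cons x.2 y) ∂(pathKernel P pol θ n x.1) := by
        refine Measurable.lintegral_kernel_prod_right' (κ := Kernel.prodMkRight (S × A)
          (pathKernel P pol θ n)) (f := fun z : (S × (S × A)) × Traj S A n =>
            f (Fin.cons z.1.2 z.2)) ?_
        exact hfc.comp ((measurable_snd.comp measurable_fst).prodMk measurable_snd)
      have h2 : Measurable fun x : S × A =>
          ∫⁻ s', ∫⁻ y, f (Fin.cons x y) ∂(pathKernel P pol θ n s') ∂(P x) :=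
        Measurable.lintegral_kernel_prod_right' (κ := P)
          (f := fun z : (S × A) × S => ∫⁻ y, f (Fin.cons z.1 y) ∂(pathKernel P pol θ n z.2))
          (h1.comp measurable_swap)
      exact h2.comp measurable_prodMk_left

/-- Conditioning on the first step. -/
theorem integral_pathKernel_succ {F : Type*} [NormedAddCommGroup F] [NormedSpace ℝ F] {n : ℕ}
    (s : S) {f : Traj S A (n + 1) → F} (hf : StronglyMeasurable f) {C : ℝ}
    (hC : ∀ τ, ‖f τ‖ ≤ C) :
    ∫ τ, f τ ∂(pathKernel P pol θ (n + 1) s) = ∫ a, ∫ s', ∫ x, f (Fin.cons (s, a) x)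
      ∂(pathKernel P pol θ n s') ∂(P (s, a)) ∂(policyKernel pol θ s) := by
  have hfc : StronglyMeasurable fun x : (S × A) × Traj S A n => f (Fin.cons x.1 x.2) :=
    hf.comp_measurable (measurable_cons n)
  rw [pathKernel, Kernel.map_apply _ (measurable_cons n),
    integral_map (measurable_cons n).aemeasurable hf.aestronglyMeasurable,
    integral_compProd, Kernel.prod_apply, Kernel.id_apply, Measure.dirac_prod, integral_map]
  · refine integral_congr_ae (Eventually.of_forall fun a => ?_)
    simp only [Kernel.prodMkLeft_apply]
    rw [Kernel.integral_comp]
    exact Integrable.of_bound (hfc.comp_measurable measurable_prodMk_left).aestronglyMeasurable C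
      (Eventually.of_forall fun x => hC _)
  · exact measurable_prodMk_left.aemeasurable
  · refine StronglyMeasurable.aestronglyMeasurable ?_
    exact hfc.integral_kernel_prod_right'' (η := Kernel.prodMkLeft S (pathKernel P pol θ n ∘ₖ P))
  · exact Integrable.of_bound hfc.aestronglyMeasurable C (Eventually.of_forall fun x => hC _)

variable {P pol} {Mg Mh : ℝ}

/-- Differentiate the identity ∫ π_θ(a|s) dν(a) = 1 in θ. -/
theorem BoundedScore.integral_score_policyKernel (h : BoundedScore pol Mg Mh) (s : S) :
    ∫ a, score pol s a θ ∂(policyKernel pol θ s) = 0 := by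
  have hi : ∀ θ, Integrable (fun a => pol.dens θ s a) ν ∧ ∫ a, pol.dens θ s a ∂ν = 1 := by
    intro θ
    have hm : Measurable fun a => pol.dens θ s a :=
      (pol.measurable_dens θ).comp measurable_prodMk_left
    have h1 := pol.lintegral_dens θ s
    have hnn : 0 ≤ᵐ[ν] fun a => pol.dens θ s a :=
      Eventually.of_forall fun a => (pol.dens_pos θ s a).le
    constructor
    · refine ⟨hm.aestronglyMeasurable, ?_⟩
      rw [hasFiniteIntegral_iff_ofReal hnn, h1]
      exact ENNReal.one_lt_top
    · rw [integral_eq_lintegral_of_nonneg_ae hnn hm.aestronglyMeasurable, h1]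
      simp
  have hd := hasGradientAt_integral_mul_density (μ := ν) (p := fun θ a => pol.dens θ s a)
    (G := fun θ a => score pol s a θ) (F := fun _ => 1) (K := Mg) (C := 1)
    (fun θ a => pol.dens_pos θ s a) (fun θ => (hi θ).1) (fun θ a => h.hasGradientAt_log s a θ)
    (fun θ a => h.norm_score_le s a θ)
    (fun θ => ((h.measurable_score θ).comp measurable_prodMk_left).aestronglyMeasurable)
    aestronglyMeasurable_const (fun _ => by simp) θ
  simp only [one_mul, (hi _).2] at hd
  have hm : Measurable fun a => ENNReal.ofReal (pol.dens θ s a) :=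
    (measurable_ofReal_dens pol θ).comp measurable_prodMk_left
  rw [policyKernel_apply, integral_withDensity_eq_integral_toReal_smul hm
    (Eventually.of_forall fun _ => ENNReal.ofReal_lt_top)]
  simp only [ENNReal.toReal_ofReal (pol.dens_pos _ _ _).le]
  exact hd.unique (hasGradientAt_const θ 1)

/-- Condition on the first step: the score at time 0 is centered under the policy, and later scores
are centered given the next state by induction. -/
theorem BoundedScore.integral_score_pathKernel (h : BoundedScore pol Mg Mh) {n : ℕ} (s : S)
    (i : Fin n) :
    ∫ τ, score pol (τ i).1 (τ i).2 θ ∂(pathKernel P pol θ n s) = 0 := by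
  induction n generalizing s with
  | zero => exact i.elim0
  | succ n ih =>
    have hm : Measurable fun τ : Traj S A (n + 1) => score pol (τ i).1 (τ i).2 θ :=
      (h.measurable_score θ).comp (measurable_pi_apply i)
    rw [integral_pathKernel_succ P pol θ s (C := Mg) hm.stronglyMeasurable
      (fun τ => h.norm_score_le _ _ _)]
    refine Fin.cases ?_ (fun i => ?_) i
    · simpa using h.integral_score_policyKernel θ s
    · simp [ih]

/-- Causality: rewards are uncorrelated with later scores. -/
theorem BoundedScore.integral_smul_score_pathKernel (h : BoundedScore pol Mg Mh) {n : ℕ} (s : S)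
    {φ : S × A → ℝ} (hφ : Measurable φ) {C : ℝ} (hC : ∀ x, |φ x| ≤ C) {i j : Fin n}
    (hij : j < i) :
    ∫ τ, φ (τ j) • score pol (τ i).1 (τ i).2 θ ∂(pathKernel P pol θ n s) = 0 := by
  induction n generalizing s with
  | zero => exact i.elim0
  | succ n ih =>
    have hm : Measurable fun τ : Traj S A (n + 1) => φ (τ j) • score pol (τ i).1 (τ i).2 θ :=
      (hφ.comp (measurable_pi_apply j)).smul
        ((h.measurable_score θ).comp (measurable_pi_apply i))
    rw [integral_pathKernel_succ P pol θ s (C := C * Mg) hm.stronglyMeasurable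
      (fun τ => by
        rw [norm_smul]
        exact mul_le_mul (hC _) (h.norm_score_le _ _ _) (norm_nonneg _)
          ((abs_nonneg _).trans (hC (τ j))))]
    -- Since j < i, the score belongs to the tail. If j = 0, the value φ is fixed by the first step
    -- and only a centered tail score remains; otherwise both indices shift down by one.
    obtain ⟨i, rfl⟩ := Fin.exists_succ_eq.2 (Fin.ne_zero_of_lt hij)
    clear hm
    revert hij
    refine Fin.cases (fun _ => ?_) (fun j hij => ?_) j
    · have h0 := fun s' => h.integral_score_pathKernel (P := P) θ s' i
      simp [integral_smul, h0]
    · have h0 := fun s' => ih s' (Fin.succ_lt_succ_iff.1 hij)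
      simp [h0]

end Kernels

end PolicyGradient

namespace PolicyGradient

/-! ### Mean square error of a momentum estimator -/

section SquareIntegrable

variable {X E : Type*} [MeasurableSpace X] {μ : Measure X} [NormedAddCommGroup E]

theorem lintegral_enorm_sq_eq_ofReal {f : X → E} (hf : MemLp f 2 μ) :
    ∫⁻ x, ‖f x‖ₑ ^ 2 ∂μ = ENNReal.ofReal (∫ x, ‖f x‖ ^ 2 ∂μ) := by
  rw [ofReal_integral_eq_lintegral_ofReal ((memLp_two_iff_integrable_sq_norm hf.1).1 hf)
    (Eventually.of_forall fun x => by positivity)]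
  refine lintegral_congr fun x => ?_
  rw [ENNReal.ofReal_pow (norm_nonneg _), ofReal_norm]

theorem memLp_two_of_lintegral_enorm_sq_lt_top {f : X → E} (hf : AEStronglyMeasurable f μ)
    (h : ∫⁻ x, ‖f x‖ₑ ^ 2 ∂μ < ⊤) : MemLp f 2 μ := by
  rw [memLp_two_iff_integrable_sq_norm hf]
  refine ⟨hf.norm.pow 2, ?_⟩
  rw [hasFiniteIntegral_iff_enorm]
  simpa using h

variable [InnerProductSpace ℝ E] [CompleteSpace E] [IsProbabilityMeasure μ]

/-- The deterministic vector e is orthogonal in mean to the centered part, so its square enters with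
coefficient exactly a². That is what makes the momentum recursion contract. Only the two noise terms
pay the factor 2 of (x+y)² ≤ 2x² + 2y². -/
theorem integral_norm_sq_add_le_of_integral_eq_zero {Y Z : X → E} (hY : MemLp Y 2 μ)
    (hZ : MemLp Z 2 μ) (hY0 : ∫ x, Y x ∂μ = 0) (hZ0 : ∫ x, Z x ∂μ = 0) (e : E) (a b c : ℝ) :
    ∫ x, ‖a • e + b • Y x + c • Z x‖ ^ 2 ∂μ ≤
      a ^ 2 * ‖e‖ ^ 2 + 2 * b ^ 2 * ∫ x, ‖Y x‖ ^ 2 ∂μ + 2 * c ^ 2 * ∫ x, ‖Z x‖ ^ 2 ∂μ := by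
  have hYi := hY.integrable one_le_two
  have hZi := hZ.integrable one_le_two
  have hY2 := (memLp_two_iff_integrable_sq_norm hY.1).1 hY
  have hZ2 := (memLp_two_iff_integrable_sq_norm hZ.1).1 hZ
  have hV := (hYi.smul b).add (hZi.smul c)
  have hV' : Integrable (fun x => inner ℝ (a • e) (b • Y x + c • Z x)) μ :=
    Integrable.const_inner (𝕜 := ℝ) (a • e) hV
  have hV0 : ∫ x, inner ℝ (a • e) (b • Y x + c • Z x) ∂μ = 0 := by
    have h1 : ∫ x, inner ℝ (a • e) (b • Y x + c • Z x) ∂μ =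
      inner ℝ (a • e) (∫ x, (b • Y x + c • Z x) ∂μ) := integral_inner hV (a • e)
    have h2 : ∫ x, (b • Y x + c • Z x) ∂μ = 0 := by
      rw [integral_add (f := fun x => b • Y x) (g := fun x => c • Z x) (hYi.smul b)
        (hZi.smul c), integral_smul, integral_smul, hY0, hZ0]
      simp
    rw [h1, h2, inner_zero_right]
  have hA : Integrable (fun x => a ^ 2 * ‖e‖ ^ 2 +
      2 * inner ℝ (a • e) (b • Y x + c • Z x)) μ := (integrable_const _).add (hV'.const_mul 2)
  have hA' : Integrable (fun x => 2 * b ^ 2 * ‖Y x‖ ^ 2 + 2 * c ^ 2 * ‖Z x‖ ^ 2) μ :=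
    (hY2.const_mul _).add (hZ2.const_mul _)
  have hr : ∫ x, (a ^ 2 * ‖e‖ ^ 2 + 2 * inner ℝ (a • e) (b • Y x + c • Z x) +
      (2 * b ^ 2 * ‖Y x‖ ^ 2 + 2 * c ^ 2 * ‖Z x‖ ^ 2)) ∂μ =
      a ^ 2 * ‖e‖ ^ 2 + 2 * b ^ 2 * ∫ x, ‖Y x‖ ^ 2 ∂μ + 2 * c ^ 2 * ∫ x, ‖Z x‖ ^ 2 ∂μ := by
    rw [integral_add hA hA', integral_add (integrable_const _) (hV'.const_mul 2),
      integral_add (hY2.const_mul _) (hZ2.const_mul _), integral_const, integral_const_mul,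
      integral_const_mul, integral_const_mul, hV0]
    simp
    ring
  rw [← hr]
  refine integral_mono_of_nonneg (Eventually.of_forall fun x => by positivity)
    (hA.add hA') (Eventually.of_forall fun x => ?_)
  have h1 : ‖a • e + b • Y x + c • Z x‖ ^ 2 = ‖a • e‖ ^ 2 +
      2 * inner ℝ (a • e) (b • Y x + c • Z x) + ‖b • Y x + c • Z x‖ ^ 2 := by
    rw [add_assoc, norm_add_sq_real]
  have h2 : ‖b • Y x + c • Z x‖ ^ 2 ≤ 2 * ‖b • Y x‖ ^ 2 + 2 * ‖c • Z x‖ ^ 2 := by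
    have := parallelogram_law_with_norm ℝ (b • Y x) (c • Z x)
    nlinarith [mul_self_nonneg ‖b • Y x - c • Z x‖]
  simp only [norm_smul, mul_pow, Real.norm_eq_abs, sq_abs] at h1 h2 ⊢
  linarith

theorem integral_norm_sq_sub_integral_le {Y : X → E} (hY : MemLp Y 2 μ) :
    ∫ x, ‖Y x - ∫ y, Y y ∂μ‖ ^ 2 ∂μ ≤ ∫ x, ‖Y x‖ ^ 2 ∂μ := by
  set e := ∫ y, Y y ∂μ with he
  have hYi := hY.integrable one_le_two
  have hY2 := (memLp_two_iff_integrable_sq_norm hY.1).1 hY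
  have hV' : Integrable (fun x => inner ℝ e (Y x)) μ := Integrable.const_inner (𝕜 := ℝ) e hYi
  have h1 : ∀ x, ‖Y x - e‖ ^ 2 = ‖Y x‖ ^ 2 - 2 * inner ℝ e (Y x) + ‖e‖ ^ 2 := by
    intro x
    rw [norm_sub_sq_real, real_inner_comm]
  have h2 : ∫ x, inner ℝ e (Y x) ∂μ = ‖e‖ ^ 2 := by
    rw [integral_inner hYi e, ← he, real_inner_self_eq_norm_sq]
  simp_rw [h1]
  rw [integral_add (f := fun x => ‖Y x‖ ^ 2 - 2 * inner ℝ e (Y x))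
    (hY2.sub (hV'.const_mul 2)) (integrable_const _),
    integral_sub hY2 (hV'.const_mul 2), integral_const_mul, h2]
  simp
  nlinarith [sq_nonneg ‖e‖]

/-- Mean square error of the importance-weighted momentum estimator, for random vectors `g'`, `g`
and a weight `w` with `E g' = m'` and `E (w g) = m`. -/
theorem lintegral_importance_momentum_error_sq_le {g' g : X → E} {w : X → ℝ} {m m' : E}
    {G δ V σ : ℝ} (hg' : MemLp g' 2 μ) (hg : AEStronglyMeasurable g μ) (hG0 : 0 ≤ G)
    (hG : ∀ x, ‖g x‖ ≤ G) (hw : MemLp w 2 μ) (hδ : ∀ x, ‖g' x - g x‖ ≤ δ)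
    (hV : ∫ x, (w x - 1) ^ 2 ∂μ ≤ V) (hm' : ∫ x, g' x ∂μ = m') (hm : ∫ x, w x • g x ∂μ = m)
    (hσ : ∫⁻ x, ‖g' x - m'‖ₑ ^ 2 ∂μ ≤ ENNReal.ofReal (σ ^ 2)) {β : ℝ} (hβ0 : 0 ≤ β)
    (hβ1 : β ≤ 1) (u : E) :
    ∫⁻ x, ‖β • g' x + (1 - β) • (u + g' x - w x • g x) - m'‖ₑ ^ 2 ∂μ ≤
      ENNReal.ofReal ((1 - β) ^ 2 * ‖u - m‖ ^ 2 + 2 * β ^ 2 * σ ^ 2 +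
        4 * (δ ^ 2 + G ^ 2 * V)) := by
  have hwg : MemLp (fun x => w x • g x) 2 μ := by
    refine (hw.const_mul G).mono (hw.1.smul hg) (Eventually.of_forall fun x => ?_)
    rw [norm_smul, norm_mul, Real.norm_of_nonneg hG0, mul_comm]
    gcongr
    exact hG x
  have hD : MemLp (fun x => g' x - w x • g x) 2 μ := hg'.sub hwg
  have hDm : ∫ x, (g' x - w x • g x) ∂μ = m' - m := by
    rw [integral_sub (hg'.integrable one_le_two) (hwg.integrable one_le_two), hm', hm]
  have hY : MemLp (fun x => g' x - m') 2 μ := hg'.sub (memLp_const _)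
  have hZ : MemLp (fun x => (g' x - w x • g x) - (m' - m)) 2 μ := hD.sub (memLp_const _)
  have hY0 : ∫ x, (g' x - m') ∂μ = 0 := by
    rw [integral_sub (hg'.integrable one_le_two) (integrable_const _), hm']
    simp
  have hZ0 : ∫ x, ((g' x - w x • g x) - (m' - m)) ∂μ = 0 := by
    rw [integral_sub (hD.integrable one_le_two) (integrable_const _), hDm]
    simp
  have hYσ : ∫ x, ‖g' x - m'‖ ^ 2 ∂μ ≤ σ ^ 2 := by
    rwa [lintegral_enorm_sq_eq_ofReal hY, ENNReal.ofReal_le_ofReal_iff (sq_nonneg _)] at hσ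
  have hw1 : MemLp (fun x => w x - 1) 2 μ := hw.sub (memLp_const 1)
  have hwi := (memLp_two_iff_integrable_sq hw1.1).1 hw1
  have hwi' : Integrable (fun x => 2 * δ ^ 2 + 2 * G ^ 2 * (w x - 1) ^ 2) μ :=
    (integrable_const _).add (hwi.const_mul _)
  have hD2 : ∫ x, ‖g' x - w x • g x‖ ^ 2 ∂μ ≤ 2 * δ ^ 2 + 2 * G ^ 2 * V := by
    calc ∫ x, ‖g' x - w x • g x‖ ^ 2 ∂μ
        ≤ ∫ x, (2 * δ ^ 2 + 2 * G ^ 2 * (w x - 1) ^ 2) ∂μ := by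
          refine integral_mono_of_nonneg (Eventually.of_forall fun x => by positivity)
            hwi' (Eventually.of_forall fun x => ?_)
          -- Splitting off w - 1 leaves a Lipschitz increment of the estimator and a bounded vector
          -- times a small scalar.
          have e : g' x - w x • g x = (g' x - g x) - (w x - 1) • g x := by module
          have h2 : ‖(w x - 1) • g x‖ ≤ |w x - 1| * G := by
            rw [norm_smul]
            exact mul_le_mul_of_nonneg_left (hG x) (norm_nonneg _)
          have h3 : ‖g' x - w x • g x‖ ≤ δ + |w x - 1| * G := by
            rw [e]
            exact (norm_sub_le _ _).trans (add_le_add (hδ x) h2)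
          have h4 := pow_le_pow_left₀ (norm_nonneg _) h3 2
          have h5 := sq_abs (w x - 1)
          simp only
          nlinarith [sq_nonneg (δ - |w x - 1| * G)]
      _ = 2 * δ ^ 2 + 2 * G ^ 2 * ∫ x, (w x - 1) ^ 2 ∂μ := by
          rw [integral_add (integrable_const _) (hwi.const_mul _), integral_const,
            integral_const_mul]
          simp
      _ ≤ _ := by gcongr
  have hZ2 := integral_norm_sq_sub_integral_le hD
  rw [hDm] at hZ2
  have hmain := integral_norm_sq_add_le_of_integral_eq_zero hY hZ hY0 hZ0 (u - m) (1 - β) β (1 - β)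
  -- The new error is the old error damped by 1 - β, plus sampling noise weighted by β, plus the
  -- centered correction weighted by 1 - β.
  have e : ∀ x, β • g' x + (1 - β) • (u + g' x - w x • g x) - m' =
      (1 - β) • (u - m) + β • (g' x - m') + (1 - β) • ((g' x - w x • g x) - (m' - m)) := by
    intro x
    module
  have hS : MemLp (fun x => (1 - β) • (u - m) + β • (g' x - m') +
      (1 - β) • ((g' x - w x • g x) - (m' - m))) 2 μ := by
    have h1 : MemLp (fun x => β • (g' x - m')) 2 μ := hY.const_smul β
    have h2 : MemLp (fun x => (1 - β) • ((g' x - w x • g x) - (m' - m))) 2 μ :=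
      hZ.const_smul (1 - β)
    have h3 : MemLp (fun _ : X => (1 - β) • (u - m)) 2 μ := memLp_const _
    exact (h3.add h1).add h2
  simp_rw [e]
  rw [lintegral_enorm_sq_eq_ofReal hS]
  refine ENNReal.ofReal_le_ofReal (hmain.trans ?_)
  have hb1 : (1 - β) ^ 2 ≤ 1 := by nlinarith
  have hb2 : 2 * β ^ 2 * ∫ x, ‖g' x - m'‖ ^ 2 ∂μ ≤ 2 * β ^ 2 * σ ^ 2 := by
    gcongr
  have hb3 : 2 * (1 - β) ^ 2 * ∫ x, ‖(g' x - w x • g x) - (m' - m)‖ ^ 2 ∂μ ≤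
      2 * 1 * (2 * δ ^ 2 + 2 * G ^ 2 * V) :=
    mul_le_mul (by linarith) (hZ2.trans hD2) (integral_nonneg fun _ => sq_nonneg _) (by norm_num)
  linarith

end SquareIntegrable

attribute [instance] MDP.markov MDP.prob

variable {S A : Type*} [MeasurableSpace S] [MeasurableSpace A] {d : ℕ} {ν : Measure A}

/-! ### The trajectory law and importance sampling -/

section Law

variable (M : MDP S A) (pol : PolicyFamily d S ν)

theorem integral_trajLaw {F : Type*} [NormedAddCommGroup F] [NormedSpace ℝ F]
    (θ : EuclideanSpace ℝ (Fin d)) (f : Traj S A M.H → F) :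
    ∫ τ, f τ ∂(trajLaw M pol θ) = ∫ τ, pathDens pol θ τ • f τ ∂(baseMeasure M ν) := by
  have hpd : Measurable fun τ : Traj S A M.H => ENNReal.ofReal (pathDens pol θ τ) :=
    (measurable_pathDens pol θ).ennreal_ofReal
  have h : trajLaw M pol θ = (baseMeasure M ν).withDensity
    fun τ => ENNReal.ofReal (pathDens pol θ τ) := rfl
  rw [h, integral_withDensity_eq_integral_toReal_smul hpd
    (Eventually.of_forall fun _ => ENNReal.ofReal_lt_top)]
  simp only [ENNReal.toReal_ofReal (pathDens_pos pol θ _).le]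

theorem integrable_trajLaw_iff {F : Type*} [NormedAddCommGroup F] [NormedSpace ℝ F]
    (θ : EuclideanSpace ℝ (Fin d)) (f : Traj S A M.H → F) :
    Integrable f (trajLaw M pol θ) ↔
      Integrable (fun τ => pathDens pol θ τ • f τ) (baseMeasure M ν) := by
  have hpd : Measurable fun τ : Traj S A M.H => ENNReal.ofReal (pathDens pol θ τ) :=
    (measurable_pathDens pol θ).ennreal_ofReal
  have h : trajLaw M pol θ = (baseMeasure M ν).withDensity
    fun τ => ENNReal.ofReal (pathDens pol θ τ) := rfl
  rw [h, integrable_withDensity_iff_integrable_smul' hpd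
    (Eventually.of_forall fun _ => ENNReal.ofReal_lt_top)]
  simp only [ENNReal.toReal_ofReal (pathDens_pos pol θ _).le]

theorem isWeight_eq_div {n : ℕ} (τ : Traj S A n) (θ' θ : EuclideanSpace ℝ (Fin d)) :
    isWeight pol τ θ' θ = pathDens pol θ' τ / pathDens pol θ τ :=
  Finset.prod_div_distrib ..

theorem measurable_isWeight {n : ℕ} (θ' θ : EuclideanSpace ℝ (Fin d)) :
    Measurable fun τ : Traj S A n => isWeight pol τ θ' θ := by
  simp_rw [isWeight_eq_div]
  exact (measurable_pathDens pol θ').div (measurable_pathDens pol θ)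

/-- Importance sampling: change of measure by the importance weight. -/
theorem integral_isWeight_smul {F : Type*} [NormedAddCommGroup F] [NormedSpace ℝ F]
    (θ' θ : EuclideanSpace ℝ (Fin d)) (f : Traj S A M.H → F) :
    ∫ τ, isWeight pol τ θ' θ • f τ ∂(trajLaw M pol θ) = ∫ τ, f τ ∂(trajLaw M pol θ') := by
  rw [integral_trajLaw, integral_trajLaw]
  refine integral_congr_ae (Eventually.of_forall fun τ => ?_)
  simp only [isWeight_eq_div, smul_smul, mul_div_cancel₀ _ (pathDens_pos pol θ τ).ne']

variable [SFinite ν]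

/-- The density description suits differentiation and change of measure; this sequential description
shows that the total mass is one and carries the causality statements. -/
theorem trajLaw_eq_bind (θ : EuclideanSpace ℝ (Fin d)) :
    trajLaw M pol θ = M.ρ₀.bind (pathKernel M.P pol θ M.H) := by
  have hpd : Measurable fun τ : Traj S A M.H => ENNReal.ofReal (pathDens pol θ τ) :=
    (measurable_pathDens pol θ).ennreal_ofReal
  refine Measure.ext_of_lintegral _ fun f hf => ?_
  have hpf : Measurable fun τ : Traj S A M.H => ENNReal.ofReal (pathDens pol θ τ) * f τ :=
    hpd.mul hf
  have h1 : ∫⁻ τ, f τ ∂(trajLaw M pol θ) =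
      ∫⁻ τ, ENNReal.ofReal (pathDens pol θ τ) * f τ ∂(baseMeasure M ν) :=
    lintegral_withDensity_eq_lintegral_mul _ hpd hf
  rw [h1, baseMeasure, Measure.lintegral_bind (Kernel.aemeasurable _) hpf.aemeasurable,
    Measure.lintegral_bind (Kernel.aemeasurable _) hf.aemeasurable]
  simp_rw [lintegral_pathKernel M.P pol θ _ _ hf]

instance isProbabilityMeasure_trajLaw (θ : EuclideanSpace ℝ (Fin d)) :
    IsProbabilityMeasure (trajLaw M pol θ) := by
  rw [trajLaw_eq_bind]
  infer_instance

instance sFinite_baseMeasure : SFinite (baseMeasure M ν) := by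
  rw [baseMeasure]
  infer_instance

theorem integrable_pathDens (θ : EuclideanSpace ℝ (Fin d)) :
    Integrable (fun τ : Traj S A M.H => pathDens pol θ τ) (baseMeasure M ν) := by
  simpa using (integrable_trajLaw_iff M pol θ fun _ => (1 : ℝ)).1 (integrable_const _)

theorem integral_pathDens (θ : EuclideanSpace ℝ (Fin d)) :
    ∫ τ : Traj S A M.H, pathDens pol θ τ ∂(baseMeasure M ν) = 1 := by
  simpa using (integral_trajLaw M pol θ fun _ => (1 : ℝ)).symm

variable {pol} {Mg Mh : ℝ}

theorem BoundedScore.integral_smul_score_trajLaw (h : BoundedScore pol Mg Mh)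
    (θ : EuclideanSpace ℝ (Fin d)) {φ : S × A → ℝ} (hφ : Measurable φ) {C : ℝ}
    (hC : ∀ x, |φ x| ≤ C) {i j : Fin M.H} (hij : j < i) :
    ∫ τ, φ (τ j) • score pol (τ i).1 (τ i).2 θ ∂(trajLaw M pol θ) = 0 := by
  have hm : Measurable fun τ : Traj S A M.H => φ (τ j) • score pol (τ i).1 (τ i).2 θ :=
    (hφ.comp (measurable_pi_apply j)).smul
      ((h.measurable_score θ).comp (measurable_pi_apply i))
  have hi : Integrable (fun τ : Traj S A M.H => φ (τ j) • score pol (τ i).1 (τ i).2 θ)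
      (trajLaw M pol θ) :=
    Integrable.of_bound hm.aestronglyMeasurable (C * Mg) (Eventually.of_forall fun τ => by
      rw [norm_smul]
      exact mul_le_mul (hC _) (h.norm_score_le _ _ _) (norm_nonneg _)
        ((abs_nonneg _).trans (hC (τ j))))
  -- Viewing the initial law as a constant kernel on a point lets the integral be disintegrated over
  -- the initial state.
  have e : trajLaw M pol θ = (pathKernel M.P pol θ M.H ∘ₖ Kernel.const Unit M.ρ₀) () := by
    rw [Kernel.comp_apply, Kernel.const_apply, trajLaw_eq_bind]
  rw [e] at hi ⊢
  rw [Kernel.integral_comp hi]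
  simp [h.integral_smul_score_pathKernel θ _ hφ hC hij]

end Law

/-! ### The policy gradient theorem and smoothness of J -/

section Bounds

variable (M : MDP S A) (pol : PolicyFamily d S ν)

theorem measurable_reward (j : Fin M.H) :
    Measurable fun τ : Traj S A M.H => M.γ ^ (j : ℕ) * M.r (τ j).1 (τ j).2 :=
  (M.measurable_r.comp (measurable_pi_apply j)).const_mul _

theorem abs_reward_le (n : ℕ) (s : S) (a : A) : |M.γ ^ n * M.r s a| ≤ M.γ ^ n * M.R := by
  have := M.γ_pos
  rw [abs_mul, abs_of_pos (by positivity)]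
  gcongr
  exact M.abs_r_le _ _

theorem sum_Ici_pow_le (h : Fin M.H) :
    ∑ j ∈ Finset.Ici h, M.γ ^ (j : ℕ) ≤ M.γ ^ (h : ℕ) / (1 - M.γ) := by
  have : ∑ j ∈ Finset.Ici h, M.γ ^ (j : ℕ) = ∑ j ∈ Finset.Ico (h : ℕ) M.H, M.γ ^ j := by
    rw [← Fin.map_valEmbedding_Ici, Finset.sum_map]
    rfl
  rw [this]
  exact geom_sum_Ico_le_of_lt_one M.γ_pos.le M.γ_lt_one

theorem sum_pow_le : ∑ h : Fin M.H, M.γ ^ (h : ℕ) ≤ 1 / (1 - M.γ) := by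
  rw [Fin.sum_univ_eq_sum_range (fun n => M.γ ^ n), Finset.range_eq_Ico]
  simpa using geom_sum_Ico_le_of_lt_one (m := 0) (n := M.H) M.γ_pos.le M.γ_lt_one

theorem sum_sum_Ici_pow_le :
    ∑ h : Fin M.H, ∑ j ∈ Finset.Ici h, M.γ ^ (j : ℕ) ≤ 1 / (1 - M.γ) ^ 2 := by
  have h1 : 0 < 1 - M.γ := sub_pos.2 M.γ_lt_one
  refine (Finset.sum_le_sum fun h _ => sum_Ici_pow_le M h).trans ?_
  rw [← Finset.sum_div, div_le_iff₀ h1]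
  refine (sum_pow_le M).trans (le_of_eq ?_)
  field_simp

theorem abs_trajReward_le (τ : Traj S A M.H) : |trajReward M τ| ≤ M.R / (1 - M.γ) := by
  refine (Finset.abs_sum_le_sum_abs _ _).trans
    ((Finset.sum_le_sum fun (j : Fin M.H) _ => abs_reward_le M j (τ j).1 (τ j).2).trans ?_)
  rw [← Finset.sum_mul]
  refine (mul_le_mul_of_nonneg_right (sum_pow_le M) M.R_pos.le).trans (le_of_eq ?_)
  ring

theorem measurable_trajReward : Measurable (trajReward M) :=
  Finset.measurable_sum _ fun j _ => measurable_reward M j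

variable {pol} {Mg Mh : ℝ}

/-- The discounts sum to at most 1/(1-γ)². With v a score this bounds g; with v a difference of
scores it gives the Lipschitz constant of g. -/
theorem norm_sum_sum_smul_le (τ : Traj S A M.H) {K : ℝ} (hK : 0 ≤ K)
    {v : Fin M.H → EuclideanSpace ℝ (Fin d)} (hv : ∀ h, ‖v h‖ ≤ K) :
    ‖∑ h : Fin M.H, ∑ j ∈ Finset.Ici h, (M.γ ^ (j : ℕ) * M.r (τ j).1 (τ j).2) • v h‖ ≤
      K * M.R / (1 - M.γ) ^ 2 := by
  calc _ ≤ ∑ h : Fin M.H, ∑ j ∈ Finset.Ici h, M.γ ^ (j : ℕ) * (M.R * K) := by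
        refine (norm_sum_le _ _).trans (Finset.sum_le_sum fun h _ => (norm_sum_le _ _).trans
          (Finset.sum_le_sum fun j _ => ?_))
        rw [norm_smul, ← mul_assoc]
        have := M.γ_pos
        have := M.R_pos
        exact mul_le_mul (abs_reward_le M j _ _) (hv h) (norm_nonneg _) (by positivity)
    _ = (∑ h : Fin M.H, ∑ j ∈ Finset.Ici h, M.γ ^ (j : ℕ)) * (M.R * K) := by
        simp_rw [Finset.sum_mul]
    _ ≤ 1 / (1 - M.γ) ^ 2 * (M.R * K) := by
        have := M.R_pos
        gcongr
        exact sum_sum_Ici_pow_le M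
    _ = _ := by ring

theorem BoundedScore.norm_pgt_le (h : BoundedScore pol Mg Mh) (hMg : 0 ≤ Mg) (τ : Traj S A M.H)
    (θ : EuclideanSpace ℝ (Fin d)) : ‖pgt M pol τ θ‖ ≤ Mg * M.R / (1 - M.γ) ^ 2 :=
  norm_sum_sum_smul_le M τ hMg fun _ => h.norm_score_le _ _ _

theorem BoundedScore.norm_pgt_sub_le (h : BoundedScore pol Mg Mh) (hMh : 0 ≤ Mh)
    (τ : Traj S A M.H) (θ θ' : EuclideanSpace ℝ (Fin d)) :
    ‖pgt M pol τ θ' - pgt M pol τ θ‖ ≤ Mh * M.R / (1 - M.γ) ^ 2 * ‖θ' - θ‖ := by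
  have := norm_sum_sum_smul_le M τ (K := Mh * ‖θ' - θ‖) (by positivity)
    (fun i => h.norm_score_sub_le (τ i).1 (τ i).2 θ θ')
  simp only [pgt, ← Finset.sum_sub_distrib, ← smul_sub]
  refine this.trans (le_of_eq ?_)
  ring

theorem BoundedScore.measurable_uncurry_pgt (h : BoundedScore pol Mg Mh) :
    Measurable fun x : EuclideanSpace ℝ (Fin d) × Traj S A M.H => pgt M pol x.2 x.1 :=
  Finset.measurable_sum _ fun i _ => Finset.measurable_sum _ fun j _ =>
    ((measurable_reward M j).comp measurable_snd).smul (h.measurable_uncurry_score.comp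
      (measurable_fst.prodMk ((measurable_pi_apply i).comp measurable_snd)))

theorem BoundedScore.measurable_pgt (h : BoundedScore pol Mg Mh)
    (θ : EuclideanSpace ℝ (Fin d)) : Measurable fun τ => pgt M pol τ θ :=
  Measurable.comp (g := fun x : EuclideanSpace ℝ (Fin d) × Traj S A M.H => pgt M pol x.2 x.1)
    (f := fun τ => (θ, τ)) (h.measurable_uncurry_pgt M) measurable_prodMk_left

theorem BoundedScore.memLp_pgt (h : BoundedScore pol Mg Mh) (hMg : 0 ≤ Mg)
    (μ : Measure (Traj S A M.H)) [IsFiniteMeasure μ] (θ : EuclideanSpace ℝ (Fin d))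
    (p : ENNReal) : MemLp (fun τ => pgt M pol τ θ) p μ :=
  MemLp.of_bound (h.measurable_pgt M θ).aestronglyMeasurable _
    (Eventually.of_forall fun τ => h.norm_pgt_le M hMg τ θ)

variable [SFinite ν]

theorem abs_perf_le (pol : PolicyFamily d S ν) (θ : EuclideanSpace ℝ (Fin d)) : |perf M pol θ| ≤ M.R / (1 - M.γ) := by
  have := norm_integral_le_of_norm_le_const (μ := trajLaw M pol θ) (f := trajReward M)
    (C := M.R / (1 - M.γ)) (Eventually.of_forall fun τ => abs_trajReward_le M τ)
  simpa [perf] using this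

/-- The policy gradient theorem, in its PGT form. -/
theorem BoundedScore.hasGradientAt_perf (h : BoundedScore pol Mg Mh)
    (θ : EuclideanSpace ℝ (Fin d)) :
    HasGradientAt (perf M pol) (∫ τ, pgt M pol τ θ ∂(trajLaw M pol θ)) θ := by
  have h1 := hasGradientAt_integral_mul_density (μ := baseMeasure M ν)
    (p := fun θ (τ : Traj S A M.H) => pathDens pol θ τ) (G := fun θ τ => pathScore pol θ τ)
    (F := trajReward M) (K := M.H * Mg) (C := M.R / (1 - M.γ)) (fun θ τ => pathDens_pos pol θ τ)
    (integrable_pathDens M pol) h.hasGradientAt_log_pathDens h.norm_pathScore_le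
    (fun θ => (h.measurable_pathScore θ).aestronglyMeasurable)
    (measurable_trajReward M).aestronglyMeasurable (abs_trajReward_le M) θ
  have h2 : perf M pol = fun θ => ∫ τ, trajReward M τ * pathDens pol θ τ ∂(baseMeasure M ν) := by
    funext θ
    rw [perf, integral_trajLaw]
    simp only [smul_eq_mul, mul_comm]
  have hint : ∀ i j : Fin M.H, Integrable (fun τ : Traj S A M.H =>
      (M.γ ^ (j : ℕ) * M.r (τ j).1 (τ j).2) • score pol (τ i).1 (τ i).2 θ)
      (trajLaw M pol θ) := by
    intro i j
    refine Integrable.of_bound ((measurable_reward M j).smul ((h.measurable_score θ).comp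
      (measurable_pi_apply i))).aestronglyMeasurable (M.γ ^ (j : ℕ) * M.R * Mg)
      (Eventually.of_forall fun τ => ?_)
    have := M.γ_pos
    have := M.R_pos
    rw [norm_smul]
    exact mul_le_mul (abs_reward_le M j _ _) (h.norm_score_le _ _ _) (norm_nonneg _)
      (by positivity)
  have h3 : ∫ τ, (trajReward M τ * pathDens pol θ τ) • pathScore pol θ τ ∂(baseMeasure M ν) =
      ∫ τ, pgt M pol τ θ ∂(trajLaw M pol θ) := by
    have e1 : ∫ τ, (trajReward M τ * pathDens pol θ τ) • pathScore pol θ τ ∂(baseMeasure M ν) =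
        ∫ τ, trajReward M τ • pathScore pol θ τ ∂(trajLaw M pol θ) := by
      rw [integral_trajLaw]
      refine integral_congr_ae (Eventually.of_forall fun τ => ?_)
      simp only [smul_smul, mul_comm]
    rw [e1]
    simp only [trajReward, pathScore, pgt, Finset.smul_sum, Finset.sum_smul]
    rw [integral_finsetSum _ fun i _ => integrable_finsetSum _ fun j _ => hint i j,
      integral_finsetSum _ fun i _ => integrable_finsetSum _ fun j _ => hint i j]
    refine Finset.sum_congr rfl fun i _ => ?_
    rw [integral_finsetSum _ fun j _ => hint i j, integral_finsetSum _ fun j _ => hint i j]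
    symm
    -- The total reward times the total score contains all pairs (i, j); those with j < i integrate
    -- to zero, which leaves the pairs in g.
    refine Finset.sum_subset (Finset.subset_univ _) fun j _ hj => ?_
    exact h.integral_smul_score_trajLaw M θ (M.measurable_r.const_mul (M.γ ^ (j : ℕ)))
      (fun x => abs_reward_le M j x.1 x.2) (by simpa using hj)
  rw [h2, ← h3]
  exact h1

theorem BoundedScore.gradient_perf (h : BoundedScore pol Mg Mh)
    (θ : EuclideanSpace ℝ (Fin d)) :
    gradient (perf M pol) θ = ∫ τ, pgt M pol τ θ ∂(trajLaw M pol θ) :=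
  (h.hasGradientAt_perf M θ).gradient

theorem BoundedScore.norm_gradient_perf_le (h : BoundedScore pol Mg Mh) (hMg : 0 ≤ Mg)
    (θ : EuclideanSpace ℝ (Fin d)) :
    ‖gradient (perf M pol) θ‖ ≤ Mg * M.R / (1 - M.γ) ^ 2 := by
  rw [h.gradient_perf]
  simpa using norm_integral_le_of_norm_le_const (μ := trajLaw M pol θ)
    (Eventually.of_forall fun τ => h.norm_pgt_le M hMg τ θ)

/-- Lipschitz dependence of expectations of bounded functions on the policy parameter. -/
theorem BoundedScore.norm_integral_trajLaw_sub_le (h : BoundedScore pol Mg Mh) {F : Type*}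
    [NormedAddCommGroup F] [NormedSpace ℝ F] {f : Traj S A M.H → F}
    (hf : StronglyMeasurable f) {C : ℝ} (hC0 : 0 ≤ C) (hC : ∀ τ, ‖f τ‖ ≤ C) (hMg : 0 ≤ Mg)
    (θ' θ : EuclideanSpace ℝ (Fin d)) :
    ‖∫ τ, f τ ∂(trajLaw M pol θ') - ∫ τ, f τ ∂(trajLaw M pol θ)‖ ≤
      C * (M.H * Mg * ‖θ' - θ‖) := by
  have key := pseudodist_le_of_le_exp_sub_one (K := C) (a := M.H * Mg)
    (D := fun θ' θ => ‖∫ τ, f τ ∂(trajLaw M pol θ') - ∫ τ, f τ ∂(trajLaw M pol θ)‖ₑ)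
    (fun x y z => by
      simp only [← edist_eq_enorm_sub]
      exact edist_triangle _ _ _) (fun x y => ?_) θ' θ
  · rw [← ofReal_norm] at key
    exact (ENNReal.ofReal_le_ofReal_iff (by positivity)).1 key
  · have hi : ∀ θ, Integrable (fun τ => pathDens pol θ τ • f τ) (baseMeasure M ν) := fun θ =>
      (integrable_trajLaw_iff M pol θ f).1
        (Integrable.of_bound hf.aestronglyMeasurable C (Eventually.of_forall hC))
    rw [← ofReal_norm, integral_trajLaw, integral_trajLaw, ← integral_sub (hi x) (hi y)]
    refine ENNReal.ofReal_le_ofReal ?_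
    have hb : ∀ τ : Traj S A M.H, ‖pathDens pol x τ • f τ - pathDens pol y τ • f τ‖ ≤
        C * (Real.exp (M.H * Mg * ‖x - y‖) - 1) * pathDens pol y τ := by
      intro τ
      rw [← sub_smul, norm_smul, mul_comm, mul_assoc]
      exact mul_le_mul (hC τ) (abs_sub_le_of_abs_log_sub_le (pathDens_pos pol y τ)
        (pathDens_pos pol x τ) (h.abs_log_pathDens_sub_le y x τ)) (norm_nonneg _) hC0
    refine (norm_integral_le_of_norm_le ((integrable_pathDens M pol y).const_mul _)
      (Eventually.of_forall hb)).trans (le_of_eq ?_)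
    rw [integral_const_mul, integral_pathDens, mul_one]

/-- ∇J is the mean of g(·|θ) under p(·|θ). Changing θ inside g costs the Lipschitz constant of g,
and changing the law costs the sup bound of g times H Mg; the two contributions add. -/
theorem BoundedScore.norm_gradient_perf_sub_le (h : BoundedScore pol Mg Mh) (hMg : 0 ≤ Mg)
    (hMh : 0 ≤ Mh) (θ' θ : EuclideanSpace ℝ (Fin d)) :
    ‖gradient (perf M pol) θ' - gradient (perf M pol) θ‖ ≤
      (Mh * M.R + M.H * Mg ^ 2 * M.R) / (1 - M.γ) ^ 2 * ‖θ' - θ‖ := by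
  have hR := M.R_pos
  have h1 := h.norm_integral_trajLaw_sub_le M (h.measurable_pgt M θ).stronglyMeasurable
    (by positivity) (fun τ => h.norm_pgt_le M hMg τ θ) hMg θ' θ
  have h2 : ‖∫ τ, pgt M pol τ θ' ∂(trajLaw M pol θ') - ∫ τ, pgt M pol τ θ ∂(trajLaw M pol θ')‖ ≤
      Mh * M.R / (1 - M.γ) ^ 2 * ‖θ' - θ‖ := by
    rw [← integral_sub ((h.memLp_pgt M hMg _ θ' 1).integrable le_rfl)
      ((h.memLp_pgt M hMg _ θ 1).integrable le_rfl)]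
    simpa using norm_integral_le_of_norm_le_const (μ := trajLaw M pol θ')
      (Eventually.of_forall fun τ => h.norm_pgt_sub_le M hMh τ θ θ')
  rw [h.gradient_perf, h.gradient_perf]
  refine (norm_sub_le_norm_sub_add_norm_sub _ (∫ τ, pgt M pol τ θ ∂(trajLaw M pol θ')) _).trans
    ((add_le_add h2 h1).trans (le_of_eq ?_))
  ring

end Bounds

/-! ### Second moments of importance weights -/

section Weight

variable [SFinite ν] (M : MDP S A) {pol : PolicyFamily d S ν} {Mg Mh W : ℝ}

theorem integral_isWeight (θ' θ : EuclideanSpace ℝ (Fin d)) :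
    ∫ τ, isWeight pol τ θ' θ ∂(trajLaw M pol θ) = 1 := by
  simpa using integral_isWeight_smul M pol θ' θ fun _ => (1 : ℝ)

variable {M}

theorem BoundedWeightVariance.memLp (hw : BoundedWeightVariance M pol W)
    (θ' θ : EuclideanSpace ℝ (Fin d)) :
    MemLp (fun τ => isWeight pol τ θ' θ) 2 (trajLaw M pol θ) :=
  (evariance_lt_top_iff_memLp (measurable_isWeight pol θ' θ).aestronglyMeasurable).1
    ((hw θ' θ).trans_lt ENNReal.ofReal_lt_top)

theorem BoundedWeightVariance.integral_sq_le (hw : BoundedWeightVariance M pol W) (hW : 0 ≤ W)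
    (θ' θ : EuclideanSpace ℝ (Fin d)) :
    ∫ τ, isWeight pol τ θ' θ ^ 2 ∂(trajLaw M pol θ) ≤ W + 1 := by
  have h1 : variance (fun τ => isWeight pol τ θ' θ) (trajLaw M pol θ) ≤ W :=
    ENNReal.toReal_le_of_le_ofReal hW (hw θ' θ)
  rw [variance_eq_sub (hw.memLp θ' θ), integral_isWeight] at h1
  simp only [Pi.pow_apply] at h1
  linarith

theorem BoundedWeightVariance.eLpNorm_le (hw : BoundedWeightVariance M pol W) (hW : 0 ≤ W)
    (θ' θ : EuclideanSpace ℝ (Fin d)) :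
    eLpNorm (fun τ => isWeight pol τ θ' θ) 2 (trajLaw M pol θ) ≤
      ENNReal.ofReal (√(W + 1)) := by
  rw [(hw.memLp θ' θ).eLpNorm_eq_integral_rpow_norm (by simp) (by simp)]
  refine ENNReal.ofReal_le_ofReal ?_
  rw [Real.sqrt_eq_rpow]
  simp only [ENNReal.toReal_ofNat, Real.rpow_ofNat, Real.norm_eq_abs, sq_abs]
  rw [show (2 : ℝ)⁻¹ = 1 / 2 by norm_num]
  exact Real.rpow_le_rpow (integral_nonneg fun _ => sq_nonneg _) (hw.integral_sq_le hW θ' θ)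
    (by norm_num)

/-- The importance weight of a parameter close to the sampling parameter is close to `1` in mean
square. -/
theorem BoundedWeightVariance.integral_sub_sq_le (hw : BoundedWeightVariance M pol W)
    (hW : 0 ≤ W) (h : BoundedScore pol Mg Mh) (hMg : 0 ≤ Mg)
    (θ' θ : EuclideanSpace ℝ (Fin d)) :
    ∫ τ, (isWeight pol τ θ' θ - 1) ^ 2 ∂(trajLaw M pol θ) ≤
      M.H ^ 2 * Mg ^ 2 * (W + 1) * ‖θ' - θ‖ ^ 2 := by
  -- The sampling parameter θ stays fixed while the target moves along the segment. Each piece then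
  -- costs a small factor times the L² norm of a weight w(·|y,θ), which is at most √(W+1) whatever y
  -- is.
  have key := pseudodist_le_of_le_exp_sub_one (K := √(W + 1)) (a := M.H * Mg)
    (D := fun x y => eLpNorm (fun τ => isWeight pol τ x θ - isWeight pol τ y θ) 2
      (trajLaw M pol θ)) (fun x y z => ?_) (fun x y => ?_) θ' θ
  · have hself : ∀ τ : Traj S A M.H, isWeight pol τ θ θ = 1 := fun τ => by
      rw [isWeight_eq_div, div_self (pathDens_pos pol θ τ).ne']
    simp only [hself] at key
    have hm := (hw.memLp θ' θ).sub (memLp_const (1 : ℝ))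
    have h1 := lintegral_enorm_sq_eq_ofReal hm
    have h2 : ∫⁻ τ, ‖isWeight pol τ θ' θ - 1‖ₑ ^ 2 ∂(trajLaw M pol θ) ≤
        ENNReal.ofReal ((√(W + 1) * (M.H * Mg * ‖θ' - θ‖)) ^ 2) := by
      rw [ENNReal.ofReal_pow (by positivity)]
      refine le_trans (le_of_eq ?_) (pow_le_pow_left' key 2)
      have := eLpNorm_nnreal_pow_eq_lintegral (f := fun τ => isWeight pol τ θ' θ - 1)
        (μ := trajLaw M pol θ) (p := 2) (by simp)
      simpa using this.symm
    have h3 : ENNReal.ofReal (∫ τ, (isWeight pol τ θ' θ - 1) ^ 2 ∂(trajLaw M pol θ)) ≤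
        ENNReal.ofReal ((√(W + 1) * (M.H * Mg * ‖θ' - θ‖)) ^ 2) := by
      refine le_trans (le_of_eq ?_) h2
      simpa using h1.symm
    rw [ENNReal.ofReal_le_ofReal_iff (by positivity), mul_pow, Real.sq_sqrt (by linarith)] at h3
    refine h3.trans (le_of_eq ?_)
    ring
  · have e : (fun τ => isWeight pol τ x θ - isWeight pol τ z θ) =
        (fun τ : Traj S A M.H => isWeight pol τ x θ - isWeight pol τ y θ) +
          fun τ => isWeight pol τ y θ - isWeight pol τ z θ := by
      funext τ
      simp
    rw [e]
    have hm := fun x => measurable_isWeight (n := M.H) pol x θ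
    exact eLpNorm_add_le ((hm x).sub (hm y)).aestronglyMeasurable
      ((hm y).sub (hm z)).aestronglyMeasurable one_le_two
  · set q := Real.exp (M.H * Mg * ‖x - y‖) - 1 with hq
    have hq0 : 0 ≤ q := by
      have : (0 : ℝ) ≤ M.H * Mg * ‖x - y‖ := by positivity
      have := Real.add_one_le_exp (M.H * Mg * ‖x - y‖)
      linarith
    have hb : ∀ τ : Traj S A M.H, ‖isWeight pol τ x θ - isWeight pol τ y θ‖ ≤
        q * isWeight pol τ y θ := by
      intro τ
      have h1 := abs_sub_le_of_abs_log_sub_le (pathDens_pos pol y τ)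
        (pathDens_pos pol x τ) (h.abs_log_pathDens_sub_le y x τ)
      have h2 := pathDens_pos pol θ τ
      rw [isWeight_eq_div, isWeight_eq_div, ← sub_div, Real.norm_eq_abs, abs_div, abs_of_pos h2,
        ← mul_div_assoc]
      gcongr
    refine (eLpNorm_mono_real hb).trans ?_
    have e : (fun τ : Traj S A M.H => q * isWeight pol τ y θ) =
      q • fun τ => isWeight pol τ y θ := rfl
    rw [e, eLpNorm_const_smul, mul_comm, ENNReal.ofReal_mul (by positivity),
      Real.enorm_eq_ofReal hq0]
    gcongr
    exact hw.eLpNorm_le hW y θ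

end Weight

/-! ### The one-step error bound for the policy gradient -/

section OneStep

variable [SFinite ν] {M : MDP S A} {pol : PolicyFamily d S ν} {Mg Mh W σ : ℝ}

/-- The conditional mean square error after one step of the momentum-based estimator. -/
theorem lintegral_momentum_error_sq_le (h : BoundedScore pol Mg Mh)
    (hg : BoundedGradientVariance M pol σ) (hw : BoundedWeightVariance M pol W) (hMg : 0 ≤ Mg)
    (hMh : 0 ≤ Mh) (hW : 0 ≤ W) {β : ℝ} (hβ0 : 0 ≤ β) (hβ1 : β ≤ 1)
    (θ θ' u : EuclideanSpace ℝ (Fin d)) :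
    ∫⁻ τ, ‖β • pgt M pol τ θ' + (1 - β) • (u + pgt M pol τ θ' -
        isWeight pol τ θ θ' • pgt M pol τ θ) - gradient (perf M pol) θ'‖ₑ ^ 2
        ∂(trajLaw M pol θ') ≤
      ENNReal.ofReal ((1 - β) ^ 2 * ‖u - gradient (perf M pol) θ‖ ^ 2 + 2 * β ^ 2 * σ ^ 2 +
        4 * ((Mh * M.R / (1 - M.γ) ^ 2) ^ 2 +
          (Mg * M.R / (1 - M.γ) ^ 2) ^ 2 * (M.H ^ 2 * Mg ^ 2 * (W + 1))) * ‖θ' - θ‖ ^ 2) := by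
  have hR := M.R_pos
  refine (lintegral_importance_momentum_error_sq_le (h.memLp_pgt M hMg (trajLaw M pol θ') θ' 2)
    (h.measurable_pgt M θ).aestronglyMeasurable (by positivity)
    (fun τ => h.norm_pgt_le M hMg τ θ) (hw.memLp θ θ')
    (fun τ => h.norm_pgt_sub_le M hMh τ θ θ') (hw.integral_sub_sq_le hW h hMg θ θ')
    (h.gradient_perf M θ').symm
    ((integral_isWeight_smul M pol θ θ' _).trans (h.gradient_perf M θ).symm) (hg θ') hβ0 hβ1
    u).trans (ENNReal.ofReal_le_ofReal (le_of_eq ?_))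
  rw [norm_sub_rev θ θ']
  ring

end OneStep

end PolicyGradient

namespace PolicyGradient

/-! ### Inexact gradient ascent -/

section Ascent

variable {E : Type*} [NormedAddCommGroup E] [InnerProductSpace ℝ E] [CompleteSpace E]

/-- The quadratic lower bound for a function with Lipschitz gradient. -/
theorem add_inner_sub_le_of_lipschitz_gradient {J : E → ℝ} {Λ : ℝ} (hJ : Differentiable ℝ J)
    (hΛ : ∀ x y, ‖gradient J x - gradient J y‖ ≤ Λ * ‖x - y‖) (x v : E) :
    J x + inner ℝ (gradient J x) v - Λ / 2 * ‖v‖ ^ 2 ≤ J (x + v) := by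
  -- The correction terms are chosen so that φ' ≥ 0 on (0, 1) by the Lipschitz bound; the claim is
  -- then φ(0) ≤ φ(1).
  set φ : ℝ → ℝ := fun t => J (x + t • v) - t * inner ℝ (gradient J x) v +
    Λ / 2 * ‖v‖ ^ 2 * t ^ 2 with hφ
  have hd : ∀ t, HasDerivAt φ (inner ℝ (gradient J (x + t • v)) v - inner ℝ (gradient J x) v +
      Λ / 2 * ‖v‖ ^ 2 * (2 * t)) t := by
    intro t
    have h1 : HasDerivAt (fun t : ℝ => x + t • v) v t := by
      simpa using ((hasDerivAt_id t).smul_const v).const_add x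
    have h2 : HasDerivAt (fun t => J (x + t • v)) (inner ℝ (gradient J (x + t • v)) v) t := by
      have := (hJ (x + t • v)).hasFDerivAt.comp_hasDerivAt t h1
      rwa [← inner_gradient_left] at this
    have h3 := (hasDerivAt_id t).mul_const (inner ℝ (gradient J x) v)
    have h4 := (hasDerivAt_pow 2 t).const_mul (Λ / 2 * ‖v‖ ^ 2)
    refine ((h2.sub h3).add h4).congr_deriv ?_
    simp
  have hmono : MonotoneOn φ (Set.Icc 0 1) := by
    refine monotoneOn_of_deriv_nonneg (convex_Icc 0 1)
      (fun t _ => (hd t).continuousAt.continuousWithinAt)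
      (fun t _ => (hd t).differentiableAt.differentiableWithinAt) fun t ht => ?_
    rw [interior_Icc] at ht
    rw [(hd t).deriv, ← inner_sub_left]
    have h1 := abs_le.1 ((abs_real_inner_le_norm (gradient J (x + t • v) - gradient J x) v))
    have h2 := hΛ (x + t • v) x
    rw [add_sub_cancel_left, norm_smul, Real.norm_of_nonneg ht.1.le] at h2
    have h3 := mul_le_mul_of_nonneg_right h2 (norm_nonneg v)
    nlinarith [h1.1]
  have := hmono (Set.left_mem_Icc.2 zero_le_one) (Set.right_mem_Icc.2 zero_le_one) zero_le_one
  simp only [hφ, zero_smul, add_zero, one_smul] at this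
  linarith

/-- One step of inexact gradient ascent. -/
theorem add_le_of_inexact_ascent {J : E → ℝ} {Λ η : ℝ} (hJ : Differentiable ℝ J)
    (hΛ : ∀ x y, ‖gradient J x - gradient J y‖ ≤ Λ * ‖x - y‖) (hη : 0 ≤ η)
    (hΛη : Λ * η ≤ 3 / 4) (x u : E) :
    J x + η / 2 * ‖gradient J x‖ ^ 2 + η / 8 * ‖u‖ ^ 2 - η / 2 * ‖u - gradient J x‖ ^ 2 ≤
      J (x + η • u) := by
  have h1 := add_inner_sub_le_of_lipschitz_gradient hJ hΛ x (η • u)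
  have h2 : ‖u - gradient J x‖ ^ 2 =
      ‖u‖ ^ 2 - 2 * inner ℝ (gradient J x) u + ‖gradient J x‖ ^ 2 := by
    rw [norm_sub_sq_real, real_inner_comm]
  rw [inner_smul_right, norm_smul, mul_pow, Real.norm_of_nonneg hη] at h1
  rw [h2]
  -- Polarization supplies (η/2)‖u‖², of which the curvature term consumes at most (3/8) η ‖u‖²; the
  -- remainder is (η/8)‖u‖².
  have h3 : Λ * η * (η * ‖u‖ ^ 2) ≤ 3 / 4 * (η * ‖u‖ ^ 2) := by gcongr
  linarith

end Ascent

/-! ### Conditional sampling and independent random times -/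

/-- Integrating out a variable with a given conditional distribution. -/
theorem lintegral_of_condExp_eq_kernel {Ω 𝓧 𝓨 : Type*} {m mΩ : MeasurableSpace Ω}
    [MeasurableSpace 𝓧] [MeasurableSpace 𝓨] {μ : Measure Ω} [IsProbabilityMeasure μ]
    (hm : m ≤ mΩ) {X : Ω → 𝓧} (hX : Measurable[m] X) {Y : Ω → 𝓨} (hY : Measurable Y)
    {κ : Kernel 𝓧 𝓨} [IsMarkovKernel κ]
    (h : ∀ B, MeasurableSet B → μ⟦Y ⁻¹' B | m⟧ =ᵐ[μ] fun ω => (κ (X ω)).real B)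
    {f : 𝓧 × 𝓨 → ENNReal} (hf : Measurable f) :
    ∫⁻ ω, f (X ω, Y ω) ∂μ = ∫⁻ ω, ∫⁻ y, f (X ω, y) ∂(κ (X ω)) ∂μ := by
  have hX' : Measurable X := hX.mono hm le_rfl
  have : IsProbabilityMeasure (μ.map fun ω => (X ω, Y ω)) :=
    Measure.isProbabilityMeasure_map (hX'.prodMk hY).aemeasurable
  have : IsProbabilityMeasure (μ.map X) := Measure.isProbabilityMeasure_map hX'.aemeasurable
  -- The joint law is compared with the kernel product on rectangles, where the hypothesis on
  -- conditional probabilities is integrated over an m-measurable set.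
  have hlaw : μ.map (fun ω => (X ω, Y ω)) = μ.map X ⊗ₘ κ := by
    refine Measure.ext_prod fun {s t} hs ht => ?_
    rw [Measure.compProd_apply_prod hs ht, Measure.map_apply (hX'.prodMk hY) (hs.prod ht),
      setLIntegral_map hs (κ.measurable_coe ht) hX']
    have hsX : MeasurableSet[m] (X ⁻¹' s) := hX hs
    have h1 : μ.real (X ⁻¹' s ∩ Y ⁻¹' t) = ∫ ω in X ⁻¹' s, (κ (X ω)).real t ∂μ := by
      rw [← setIntegral_congr_ae (hm _ hsX) ((h t ht).mono fun ω hω _ => hω),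
        setIntegral_condExp hm ((integrable_const (1 : ℝ)).indicator (hY ht)) hsX,
        setIntegral_indicator (hY ht)]
      simp
    have h2 : ∫⁻ ω in X ⁻¹' s, κ (X ω) t ∂μ =
        ENNReal.ofReal (∫ ω in X ⁻¹' s, (κ (X ω)).real t ∂μ) := by
      rw [ofReal_integral_eq_lintegral_ofReal _
        (Eventually.of_forall fun ω => measureReal_nonneg)]
      · simp
      · refine Integrable.of_bound
          ((κ.measurable_coe ht).comp hX').ennreal_toReal.aestronglyMeasurable 1 ?_
        exact Eventually.of_forall fun ω => by
          rw [Real.norm_of_nonneg measureReal_nonneg]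
          exact measureReal_le_one
    rw [h2, ← h1, ofReal_measureReal]
    rfl
  have h1 : ∫⁻ ω, f (X ω, Y ω) ∂μ = ∫⁻ z, f z ∂(μ.map fun ω => (X ω, Y ω)) :=
    (lintegral_map hf (hX'.prodMk hY)).symm
  rw [h1, hlaw, Measure.lintegral_compProd hf, lintegral_map hf.lintegral_kernel_prod_right' hX']

/-- The mean of a process at an independent uniform time. -/
theorem integral_uniform_time {Ω : Type*} {m mΩ : MeasurableSpace Ω} {μ : Measure Ω}
    [IsProbabilityMeasure μ] {ζ : Ω → ℕ} (hζ : Measurable ζ) {T : ℕ} (hT : 1 ≤ T)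
    (hunif : μ.map ζ = uniformOn (Set.Icc 1 T))
    (hind : Indep (MeasurableSpace.comap ζ inferInstance) m μ) {f : ℕ → Ω → ℝ}
    (hf : ∀ t, 1 ≤ t → t ≤ T → Measurable[m] (f t))
    (hfi : ∀ t, 1 ≤ t → t ≤ T → Integrable (f t) μ) :
    Integrable (fun ω => f (ζ ω) ω) μ ∧
      ∫ ω, f (ζ ω) ω ∂μ = 1 / (T : ℝ) * ∑ t ∈ Finset.Icc 1 T, ∫ ω, f t ω ∂μ := by
  have hprob : ∀ t ∈ Finset.Icc 1 T, μ.real (ζ ⁻¹' {t}) = 1 / T := by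
    intro t ht
    rw [measureReal_def, ← Measure.map_apply hζ (measurableSet_singleton t), hunif]
    have := uniformOn_apply_finset (s := Finset.Icc 1 T) (t := {t})
    rw [Finset.coe_Icc, Finset.coe_singleton] at this
    rw [this, Finset.inter_singleton_of_mem ht]
    simp
  have hrange : ∀ᵐ ω ∂μ, ζ ω ∈ Finset.Icc 1 T := by
    have hS : MeasurableSet (Set.Icc 1 T) := measurableSet_Icc
    have hpre : {ω | ζ ω ∈ Finset.Icc 1 T} = ζ ⁻¹' Set.Icc 1 T := by
      ext
      simp
    refine (mem_ae_iff_prob_eq_one (s := {ω | ζ ω ∈ Finset.Icc 1 T}) (hpre ▸ hζ hS)).2 ?_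
    rw [hpre, ← Measure.map_apply hζ hS, hunif,
      uniformOn_self (Set.finite_Icc 1 T) (Set.nonempty_Icc.2 hT)]
  have hae : (fun ω => f (ζ ω) ω) =ᵐ[μ]
      fun ω => ∑ t ∈ Finset.Icc 1 T, (ζ ⁻¹' {t}).indicator (fun _ => (1 : ℝ)) ω * f t ω := by
    filter_upwards [hrange] with ω hω
    rw [Finset.sum_eq_single_of_mem (ζ ω) hω fun t _ ht => by
      rw [Set.indicator_of_notMem (by simpa using ht.symm), zero_mul]]
    simp
  have hterm : ∀ t ∈ Finset.Icc 1 T,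
      Integrable (fun ω => (ζ ⁻¹' {t}).indicator (fun _ => (1 : ℝ)) ω * f t ω) μ ∧
      ∫ ω, (ζ ⁻¹' {t}).indicator (fun _ => (1 : ℝ)) ω * f t ω ∂μ =
        1 / T * ∫ ω, f t ω ∂μ := by
    intro t ht
    obtain ⟨ht1, ht2⟩ := Finset.mem_Icc.1 ht
    have hS : MeasurableSet (ζ ⁻¹' {t}) := hζ (measurableSet_singleton t)
    have hI : Integrable ((ζ ⁻¹' {t}).indicator fun _ => (1 : ℝ)) μ :=
      (integrable_const 1).indicator hS
    have hindep : IndepFun ((ζ ⁻¹' {t}).indicator fun _ => (1 : ℝ)) (f t) μ := by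
      have h0 : IndepFun ζ (f t) μ :=
        indep_of_indep_of_le_right hind (hf t ht1 ht2).comap_le
      have hφ : Measurable (({t} : Set ℕ).indicator fun _ => (1 : ℝ)) :=
        measurable_const.indicator (measurableSet_singleton t)
      exact h0.comp hφ measurable_id
    refine ⟨hindep.integrable_mul hI (hfi t ht1 ht2), ?_⟩
    have h2 := hindep.integral_mul_eq_mul_integral hI.aestronglyMeasurable
      (hfi t ht1 ht2).aestronglyMeasurable
    simp only [Pi.mul_apply] at h2
    rw [h2, integral_indicator_const _ hS, hprob t ht]
    simp
  refine ⟨(integrable_finsetSum _ fun t ht => (hterm t ht).1).congr hae.symm, ?_⟩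
  rw [integral_congr_ae hae, integral_finsetSum _ fun t ht => (hterm t ht).1, Finset.mul_sum]
  exact Finset.sum_congr rfl fun t ht => (hterm t ht).2

end PolicyGradient

namespace PolicyGradient

/-! ### Runs: adaptedness of the iterates -/

variable {S A : Type*} [MeasurableSpace S] [MeasurableSpace A] {d : ℕ} {ν : Measure A}
  {M : MDP S A} {pol : PolicyFamily d S ν} {Mg Mh : ℝ}

/-- The momentum estimator as a function of `(θ_t, θ_{t+1}, u_t)` and `τ_{t+1}`. -/
noncomputable def momentumUpdate (M : MDP S A) (pol : PolicyFamily d S ν) (β : ℝ)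
    (x : (EuclideanSpace ℝ (Fin d) × EuclideanSpace ℝ (Fin d) × EuclideanSpace ℝ (Fin d)) ×
      Traj S A M.H) : EuclideanSpace ℝ (Fin d) :=
  β • pgt M pol x.2 x.1.2.1 + (1 - β) • (x.1.2.2 + pgt M pol x.2 x.1.2.1 -
    isWeight pol x.2 x.1.1 x.1.2.1 • pgt M pol x.2 x.1.1)

theorem BoundedScore.measurable_momentumUpdate (h : BoundedScore pol Mg Mh) (β : ℝ) :
    Measurable (momentumUpdate M pol β) := by
  have hθ : Measurable fun x : (EuclideanSpace ℝ (Fin d) × EuclideanSpace ℝ (Fin d) ×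
      EuclideanSpace ℝ (Fin d)) × Traj S A M.H => (x.1.1, x.2) := by fun_prop
  have hθ' : Measurable fun x : (EuclideanSpace ℝ (Fin d) × EuclideanSpace ℝ (Fin d) ×
      EuclideanSpace ℝ (Fin d)) × Traj S A M.H => (x.1.2.1, x.2) := by fun_prop
  have hu : Measurable fun x : (EuclideanSpace ℝ (Fin d) × EuclideanSpace ℝ (Fin d) ×
      EuclideanSpace ℝ (Fin d)) × Traj S A M.H => x.1.2.2 := by fun_prop
  have hg := (h.measurable_uncurry_pgt M).comp hθ
  have hg' := (h.measurable_uncurry_pgt M).comp hθ'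
  have hw : Measurable fun x : (EuclideanSpace ℝ (Fin d) × EuclideanSpace ℝ (Fin d) ×
      EuclideanSpace ℝ (Fin d)) × Traj S A M.H => isWeight pol x.2 x.1.1 x.1.2.1 := by
    simp_rw [isWeight_eq_div]
    exact ((h.measurable_uncurry_pathDens M.H).comp hθ).div
      ((h.measurable_uncurry_pathDens M.H).comp hθ')
  exact (hg'.const_smul β).add (((hu.add hg').sub (hw.smul hg)).const_smul (1 - β))

namespace IsRun

variable {k m c : ℝ} {θ₁ : EuclideanSpace ℝ (Fin d)} {T : ℕ} {Ω : Type*} [mΩ : MeasurableSpace Ω]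
  {μ : Measure Ω} {ℱ : Filtration ℕ mΩ} {τ : ℕ → Ω → Traj S A M.H}
  {θ u : ℕ → Ω → EuclideanSpace ℝ (Fin d)} {ζ : Ω → ℕ}

theorem u_succ_eq (hrun : IsRun M pol k m c θ₁ T μ ℱ τ θ u ζ) {t : ℕ} (h1 : 1 ≤ t) (hT : t < T)
    (ω : Ω) : u (t + 1) ω = momentumUpdate M pol (c * stepSize k m t ^ 2)
      ((θ t ω, θ (t + 1) ω, u t ω), τ (t + 1) ω) :=
  hrun.u_succ t h1 hT ω

/-- The shift in the filtration index is the point: θ_{t+1} is already known at time t, before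
τ_{t+1} is drawn. The two claims feed each other, hence the joint induction. -/
theorem measurable_iterates (hrun : IsRun M pol k m c θ₁ T μ ℱ τ θ u ζ)
    (h : BoundedScore pol Mg Mh) (t : ℕ) :
    (t ≤ T → Measurable[ℱ t] (θ (t + 1))) ∧ (t < T → Measurable[ℱ (t + 1)] (u (t + 1))) := by
  induction t with
  | zero =>
    have hθ : Measurable[ℱ 0] (θ 1) := by
      rw [show θ 1 = fun _ => θ₁ from funext hrun.init]
      exact measurable_const
    refine ⟨fun _ => hθ, fun hT => ?_⟩
    have hu : u 1 = fun ω => pgt M pol (τ 1 ω) (θ 1 ω) := funext hrun.u_one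
    change Measurable[ℱ 1] (u 1)
    rw [hu]
    have hτ := hrun.adapted 1 le_rfl hT
    have hθ' : Measurable[ℱ 1] (θ 1) := hθ.mono (ℱ.mono zero_le_one) le_rfl
    have hpair : Measurable[ℱ 1] fun ω => (θ 1 ω, τ 1 ω) := hθ'.prodMk hτ
    have hg := h.measurable_uncurry_pgt M
    have hc := hg.comp hpair
    exact hc
  | succ t ih =>
    have hθ : t + 1 ≤ T → Measurable[ℱ (t + 1)] (θ (t + 1 + 1)) := by
      intro hT
      rw [show θ (t + 1 + 1) = fun ω => θ (t + 1) ω + stepSize k m (t + 1) • u (t + 1) ω from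
        funext (hrun.θ_succ (t + 1) (by omega) hT)]
      have h1 : Measurable[ℱ (t + 1)] (θ (t + 1)) :=
        (ih.1 (by omega)).mono (ℱ.mono (by omega)) le_rfl
      exact h1.add ((ih.2 (by omega)).const_smul (stepSize k m (t + 1)))
    refine ⟨hθ, fun hT => ?_⟩
    rw [show u (t + 1 + 1) = _ from funext (hrun.u_succ_eq (t := t + 1) (by omega) hT)]
    have h1 : Measurable[ℱ (t + 1 + 1)] (θ (t + 1)) :=
      (ih.1 (by omega)).mono (ℱ.mono (by omega)) le_rfl
    have h2 : Measurable[ℱ (t + 1 + 1)] (θ (t + 1 + 1)) :=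
      (hθ hT.le).mono (ℱ.mono (by omega)) le_rfl
    have h3 : Measurable[ℱ (t + 1 + 1)] (u (t + 1)) :=
      (ih.2 (by omega)).mono (ℱ.mono (by omega)) le_rfl
    have h4 := hrun.adapted (t + 1 + 1) (by omega) hT
    have hpair : Measurable[ℱ (t + 1 + 1)] fun ω =>
        ((θ (t + 1) ω, θ (t + 1 + 1) ω, u (t + 1) ω), τ (t + 1 + 1) ω) :=
      (h1.prodMk (h2.prodMk h3)).prodMk h4
    exact Measurable.comp (g := momentumUpdate M pol _) (h.measurable_momentumUpdate _) hpair

theorem measurable_θ (hrun : IsRun M pol k m c θ₁ T μ ℱ τ θ u ζ) (h : BoundedScore pol Mg Mh)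
    {t : ℕ} (h1 : 1 ≤ t) (hT : t ≤ T + 1) : Measurable[ℱ (t - 1)] (θ t) := by
  obtain ⟨s, rfl⟩ := Nat.exists_eq_add_of_le' h1
  exact (hrun.measurable_iterates h s).1 (by omega)

theorem measurable_u (hrun : IsRun M pol k m c θ₁ T μ ℱ τ θ u ζ) (h : BoundedScore pol Mg Mh)
    {t : ℕ} (h1 : 1 ≤ t) (hT : t ≤ T) : Measurable[ℱ t] (u t) := by
  obtain ⟨s, rfl⟩ := Nat.exists_eq_add_of_le' h1
  exact (hrun.measurable_iterates h s).2 (by omega)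

theorem memLp_u_one [IsFiniteMeasure μ] (hrun : IsRun M pol k m c θ₁ T μ ℱ τ θ u ζ) (h : BoundedScore pol Mg Mh)
    (hMg : 0 ≤ Mg) (hT : 1 ≤ T) : MemLp (u 1) 2 μ := by
  refine MemLp.of_bound ((hrun.measurable_u h le_rfl hT).mono (ℱ.le _) le_rfl).aestronglyMeasurable
    (Mg * M.R / (1 - M.γ) ^ 2) (Eventually.of_forall fun ω => ?_)
  rw [hrun.u_one]
  exact h.norm_pgt_le M hMg _ _

end IsRun

section

variable [SFinite ν]

/-- The trajectory law as a kernel in the policy parameter. -/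
noncomputable def trajKernel (M : MDP S A) (pol : PolicyFamily d S ν) :
    Kernel (EuclideanSpace ℝ (Fin d)) (Traj S A M.H) :=
  (Kernel.const _ (baseMeasure M ν)).withDensity fun θ τ => ENNReal.ofReal (pathDens pol θ τ)

theorem BoundedScore.trajKernel_apply (h : BoundedScore pol Mg Mh)
    (θ : EuclideanSpace ℝ (Fin d)) : trajKernel M pol θ = trajLaw M pol θ := by
  have hm : Measurable (Function.uncurry fun θ (τ : Traj S A M.H) =>
      ENNReal.ofReal (pathDens pol θ τ)) := (h.measurable_uncurry_pathDens M.H).ennreal_ofReal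
  rw [trajKernel, Kernel.withDensity_apply _ hm, Kernel.const_apply]
  rfl

theorem BoundedScore.isMarkovKernel_trajKernel (h : BoundedScore pol Mg Mh) :
    IsMarkovKernel (trajKernel M pol) :=
  ⟨fun θ => by rw [h.trajKernel_apply]; infer_instance⟩

theorem BoundedScore.differentiable_perf (h : BoundedScore pol Mg Mh) :
    Differentiable ℝ (perf M pol) :=
  fun θ => (h.hasGradientAt_perf M θ).differentiableAt

theorem BoundedScore.continuous_gradient_perf (h : BoundedScore pol Mg Mh) (hMg : 0 ≤ Mg)
    (hMh : 0 ≤ Mh) : Continuous (gradient (perf M pol)) := by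
  have hR := M.R_pos
  refine (LipschitzWith.of_dist_le_mul
    (K := ⟨(Mh * M.R + M.H * Mg ^ 2 * M.R) / (1 - M.γ) ^ 2, by positivity⟩)
    fun x y => ?_).continuous
  rw [dist_eq_norm, dist_eq_norm]
  exact h.norm_gradient_perf_sub_le M hMg hMh x y

end

/-! ### Runs: recursions between expectations -/

namespace IsRun

variable {k m c : ℝ} {θ₁ : EuclideanSpace ℝ (Fin d)} {T : ℕ} {Ω : Type*} [mΩ : MeasurableSpace Ω]
  {μ : Measure Ω} {ℱ : Filtration ℕ mΩ} {τ : ℕ → Ω → Traj S A M.H}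
  {θ u : ℕ → Ω → EuclideanSpace ℝ (Fin d)} {ζ : Ω → ℕ} [SFinite ν] [IsProbabilityMeasure μ]

/-- Given the past, the trajectory sampled in iteration `t + 1` can be integrated out. -/
theorem lintegral_sample (hrun : IsRun M pol k m c θ₁ T μ ℱ τ θ u ζ)
    (h : BoundedScore pol Mg Mh) {t : ℕ} (hT : t < T) {𝓧 : Type*} [MeasurableSpace 𝓧] {X : Ω → 𝓧}
    (hX : Measurable[ℱ t] X) {p : 𝓧 → EuclideanSpace ℝ (Fin d)} (hp : Measurable p)
    (hpX : ∀ ω, p (X ω) = θ (t + 1) ω) {f : 𝓧 × Traj S A M.H → ENNReal} (hf : Measurable f) :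
    ∫⁻ ω, f (X ω, τ (t + 1) ω) ∂μ =
      ∫⁻ ω, ∫⁻ y, f (X ω, y) ∂(trajLaw M pol (θ (t + 1) ω)) ∂μ := by
  have := h.isMarkovKernel_trajKernel (M := M)
  have hk : ∀ ω, (trajKernel M pol).comap p hp (X ω) = trajLaw M pol (θ (t + 1) ω) := by
    intro ω
    rw [Kernel.comap_apply, hpX, h.trajKernel_apply]
  have h1 := lintegral_of_condExp_eq_kernel (ℱ.le t) hX
    ((hrun.adapted (t + 1) (by omega) hT).mono (ℱ.le _) le_rfl)
    (κ := (trajKernel M pol).comap p hp) (fun B hB => by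
      simp_rw [hk]
      exact hrun.sample t hT B hB) hf
  rw [h1]
  simp_rw [hk]

theorem memLp_gradient (hrun : IsRun M pol k m c θ₁ T μ ℱ τ θ u ζ) (h : BoundedScore pol Mg Mh)
    (hMg : 0 ≤ Mg) (hMh : 0 ≤ Mh) {t : ℕ} (h1 : 1 ≤ t) (hT : t ≤ T + 1) (p : ENNReal) :
    MemLp (fun ω => gradient (perf M pol) (θ t ω)) p μ :=
  MemLp.of_bound ((h.continuous_gradient_perf hMg hMh).measurable.comp
    ((hrun.measurable_θ h h1 hT).mono (ℱ.le _) le_rfl)).aestronglyMeasurable _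
    (Eventually.of_forall fun _ => h.norm_gradient_perf_le M hMg _)

theorem integral_error_one_le (hrun : IsRun M pol k m c θ₁ T μ ℱ τ θ u ζ)
    (h : BoundedScore pol Mg Mh) {σ : ℝ} (hg : BoundedGradientVariance M pol σ) (hMg : 0 ≤ Mg)
    (hMh : 0 ≤ Mh) (hT : 1 ≤ T) :
    ∫ ω, ‖u 1 ω - gradient (perf M pol) (θ 1 ω)‖ ^ 2 ∂μ ≤ σ ^ 2 := by
  have hm := (hrun.memLp_u_one h hMg hT).sub
    (hrun.memLp_gradient h hMg hMh (t := 1) le_rfl (by omega) 2)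
  have hf : Measurable fun x : EuclideanSpace ℝ (Fin d) × Traj S A M.H =>
      ‖pgt M pol x.2 x.1 - gradient (perf M pol) x.1‖ₑ ^ 2 :=
    (((h.measurable_uncurry_pgt M).sub
      ((h.continuous_gradient_perf hMg hMh).measurable.comp measurable_fst)).enorm).pow_const 2
  have h1 := hrun.lintegral_sample h (t := 0) hT (hrun.measurable_θ h le_rfl (by omega))
    measurable_id (fun _ => rfl) hf
  have h2 : ∫⁻ ω, ‖u 1 ω - gradient (perf M pol) (θ 1 ω)‖ₑ ^ 2 ∂μ ≤ ENNReal.ofReal (σ ^ 2) := by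
    simp_rw [hrun.u_one]
    refine h1.le.trans ?_
    refine (lintegral_mono fun ω => hg (θ 1 ω)).trans ?_
    simp
  have h3 := lintegral_enorm_sq_eq_ofReal hm
  simp only [Pi.sub_apply] at h3
  rwa [h3, ENNReal.ofReal_le_ofReal_iff (sq_nonneg _)] at h2

-- Freeze (θ_t, θ_{t+1}, u_t), integrate out τ_{t+1} by the one-step bound, and use ‖θ_{t+1} - θ_t‖
-- = η_t ‖u_t‖. Square integrability of the new estimator is proved together with the recursion,
-- since importance weights need not be bounded and it can only be propagated along the run.
theorem error_succ (hrun : IsRun M pol k m c θ₁ T μ ℱ τ θ u ζ)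
    (h : BoundedScore pol Mg Mh) {σ W B : ℝ} (hg : BoundedGradientVariance M pol σ)
    (hw : BoundedWeightVariance M pol W) (hMg : 0 ≤ Mg) (hMh : 0 ≤ Mh) (hW : 0 ≤ W)
    (hB : (Mh * M.R / (1 - M.γ) ^ 2) ^ 2 +
          (Mg * M.R / (1 - M.γ) ^ 2) ^ 2 * (M.H ^ 2 * Mg ^ 2 * (W + 1)) ≤ B ^ 2)
    {t : ℕ} (h1 : 1 ≤ t) (hT : t < T) (hβ0 : 0 ≤ c * stepSize k m t ^ 2)
    (hβ1 : c * stepSize k m t ^ 2 ≤ 1) (hu : MemLp (u t) 2 μ) :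
    MemLp (u (t + 1)) 2 μ ∧
      ∫ ω, ‖u (t + 1) ω - gradient (perf M pol) (θ (t + 1) ω)‖ ^ 2 ∂μ ≤
        (1 - c * stepSize k m t ^ 2) ^ 2 *
          ∫ ω, ‖u t ω - gradient (perf M pol) (θ t ω)‖ ^ 2 ∂μ +
        2 * (c * stepSize k m t ^ 2) ^ 2 * σ ^ 2 +
        4 * B ^ 2 * stepSize k m t ^ 2 * ∫ ω, ‖u t ω‖ ^ 2 ∂μ := by
  set β := c * stepSize k m t ^ 2 with hβ
  set η := stepSize k m t with hη
  have hgt := hrun.memLp_gradient h hMg hMh h1 (by omega) 2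
  have hgt' := hrun.memLp_gradient h hMg hMh (t := t + 1) (by omega) (by omega) 2
  have he : MemLp (fun ω => u t ω - gradient (perf M pol) (θ t ω)) 2 μ := hu.sub hgt
  have he2 := (memLp_two_iff_integrable_sq_norm he.1).1 he
  have hu2 := (memLp_two_iff_integrable_sq_norm hu.1).1 hu
  have hθm : Measurable[ℱ t] (θ t) :=
    (hrun.measurable_θ h h1 (by omega)).mono (ℱ.mono (by omega)) le_rfl
  have hθm' : Measurable[ℱ t] (θ (t + 1)) := hrun.measurable_θ h (t := t + 1) (by omega) (by omega)
  have hum : Measurable[ℱ t] (u t) := hrun.measurable_u h h1 hT.le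
  have hum' : Measurable (u (t + 1)) :=
    (hrun.measurable_u h (t := t + 1) (by omega) hT).mono (ℱ.le _) le_rfl
  have hf : Measurable fun x : (EuclideanSpace ℝ (Fin d) × EuclideanSpace ℝ (Fin d) ×
      EuclideanSpace ℝ (Fin d)) × Traj S A M.H =>
      ‖momentumUpdate M pol β x - gradient (perf M pol) x.1.2.1‖ₑ ^ 2 := by
    have hx : Measurable fun x : (EuclideanSpace ℝ (Fin d) × EuclideanSpace ℝ (Fin d) ×
      EuclideanSpace ℝ (Fin d)) × Traj S A M.H => x.1.2.1 := by fun_prop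
    exact (((h.measurable_momentumUpdate β).sub
      ((h.continuous_gradient_perf hMg hMh).measurable.comp hx)).enorm).pow_const 2
  have hlaw := hrun.lintegral_sample h hT (hθm.prodMk (hθm'.prodMk hum))
    (p := fun x => x.2.1) (by fun_prop) (fun _ => rfl) hf
  have hint : Integrable (fun ω => (1 - β) ^ 2 * ‖u t ω - gradient (perf M pol) (θ t ω)‖ ^ 2 +
      2 * β ^ 2 * σ ^ 2 + 4 * B ^ 2 * η ^ 2 * ‖u t ω‖ ^ 2) μ :=
    ((he2.const_mul _).add (integrable_const _)).add (hu2.const_mul _)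
  -- Lower Lebesgue integrals avoid presupposing that the new error is square integrable; finiteness
  -- of the right side then yields it.
  have hle : ∫⁻ ω, ‖u (t + 1) ω - gradient (perf M pol) (θ (t + 1) ω)‖ₑ ^ 2 ∂μ ≤
      ENNReal.ofReal (∫ ω, ((1 - β) ^ 2 * ‖u t ω - gradient (perf M pol) (θ t ω)‖ ^ 2 +
      2 * β ^ 2 * σ ^ 2 + 4 * B ^ 2 * η ^ 2 * ‖u t ω‖ ^ 2) ∂μ) := by
    simp_rw [hrun.u_succ_eq h1 hT]
    refine hlaw.le.trans ?_
    rw [ofReal_integral_eq_lintegral_ofReal hint (Eventually.of_forall fun ω => by positivity)]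
    refine lintegral_mono fun ω => ?_
    refine (lintegral_momentum_error_sq_le h hg hw hMg hMh hW hβ0 hβ1 (θ t ω) (θ (t + 1) ω)
      (u t ω)).trans (ENNReal.ofReal_le_ofReal ?_)
    have hΔ : ‖θ (t + 1) ω - θ t ω‖ ^ 2 = η ^ 2 * ‖u t ω‖ ^ 2 := by
      rw [hrun.θ_succ t h1 hT.le ω, add_sub_cancel_left, norm_smul, mul_pow, Real.norm_eq_abs,
        sq_abs]
    rw [hΔ]
    have := mul_le_mul_of_nonneg_right hB (by positivity : 0 ≤ η ^ 2 * ‖u t ω‖ ^ 2)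
    linarith
  have hmem : MemLp (fun ω => u (t + 1) ω - gradient (perf M pol) (θ (t + 1) ω)) 2 μ :=
    memLp_two_of_lintegral_enorm_sq_lt_top (hum'.aestronglyMeasurable.sub hgt'.1)
      (hle.trans_lt ENNReal.ofReal_lt_top)
  have hsum : (fun ω => u (t + 1) ω - gradient (perf M pol) (θ (t + 1) ω)) +
      (fun ω => gradient (perf M pol) (θ (t + 1) ω)) = u (t + 1) := by
    funext ω
    simp
  refine ⟨hsum ▸ hmem.add hgt', ?_⟩
  rw [lintegral_enorm_sq_eq_ofReal hmem, ENNReal.ofReal_le_ofReal_iff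
    (integral_nonneg fun ω => by positivity)] at hle
  refine hle.trans (le_of_eq ?_)
  rw [integral_add (f := fun ω => (1 - β) ^ 2 * ‖u t ω - gradient (perf M pol) (θ t ω)‖ ^ 2 +
      2 * β ^ 2 * σ ^ 2) ((he2.const_mul _).add (integrable_const _)) (hu2.const_mul _),
    integral_add (he2.const_mul _) (integrable_const _), integral_const_mul, integral_const,
    integral_const_mul]
  simp

theorem memLp_u (hrun : IsRun M pol k m c θ₁ T μ ℱ τ θ u ζ)
    (h : BoundedScore pol Mg Mh) {σ W : ℝ} (hg : BoundedGradientVariance M pol σ)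
    (hw : BoundedWeightVariance M pol W) (hMg : 0 ≤ Mg) (hMh : 0 ≤ Mh) (hW : 0 ≤ W)
    (hβ0 : ∀ t, 0 ≤ c * stepSize k m t ^ 2) (hβ1 : ∀ t, c * stepSize k m t ^ 2 ≤ 1)
    {t : ℕ} (h1 : 1 ≤ t) (hT : t ≤ T) : MemLp (u t) 2 μ := by
  induction t, h1 using Nat.le_induction with
  | base => exact hrun.memLp_u_one h hMg hT
  | succ t h1 ih =>
    have hR := M.R_pos
    -- Only membership in L² is wanted, so B is taken to be the square root of the constant it has
    -- to dominate.
    exact (hrun.error_succ h hg hw hMg hMh hW (Real.sq_sqrt (by positivity)).ge h1 (by omega)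
      (hβ0 t) (hβ1 t) (ih (by omega))).1

theorem integrable_perf (hrun : IsRun M pol k m c θ₁ T μ ℱ τ θ u ζ)
    (h : BoundedScore pol Mg Mh) {t : ℕ} (h1 : 1 ≤ t) (hT : t ≤ T + 1) :
    Integrable (fun ω => perf M pol (θ t ω)) μ :=
  Integrable.of_bound ((h.differentiable_perf (M := M)).continuous.measurable.comp
    ((hrun.measurable_θ h h1 hT).mono (ℱ.le _) le_rfl)).aestronglyMeasurable _
    (Eventually.of_forall fun _ => abs_perf_le M pol _)

/-- The expected ascent in iteration `t`. -/
theorem integral_perf_succ_ge (hrun : IsRun M pol k m c θ₁ T μ ℱ τ θ u ζ)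
    (h : BoundedScore pol Mg Mh) (hMg : 0 ≤ Mg) (hMh : 0 ≤ Mh)
    {t : ℕ} (h1 : 1 ≤ t) (hT : t ≤ T) (hu : MemLp (u t) 2 μ) (hη : 0 ≤ stepSize k m t)
    (hΛ : (Mh * M.R + M.H * Mg ^ 2 * M.R) / (1 - M.γ) ^ 2 * stepSize k m t ≤ 3 / 4) :
    ∫ ω, perf M pol (θ t ω) ∂μ +
      stepSize k m t / 2 * ∫ ω, ‖gradient (perf M pol) (θ t ω)‖ ^ 2 ∂μ +
      stepSize k m t / 8 * ∫ ω, ‖u t ω‖ ^ 2 ∂μ -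
      stepSize k m t / 2 * ∫ ω, ‖u t ω - gradient (perf M pol) (θ t ω)‖ ^ 2 ∂μ ≤
      ∫ ω, perf M pol (θ (t + 1) ω) ∂μ := by
  have hgt := hrun.memLp_gradient h hMg hMh h1 (by omega) 2
  have he : MemLp (fun ω => u t ω - gradient (perf M pol) (θ t ω)) 2 μ := hu.sub hgt
  have he2 := (memLp_two_iff_integrable_sq_norm he.1).1 he
  have hu2 := (memLp_two_iff_integrable_sq_norm hu.1).1 hu
  have hg2 := (memLp_two_iff_integrable_sq_norm hgt.1).1 hgt
  have hJ := hrun.integrable_perf h h1 (by omega)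
  have hJ' := hrun.integrable_perf h (t := t + 1) (by omega) (by omega)
  have i1 : Integrable (fun ω => perf M pol (θ t ω) +
      stepSize k m t / 2 * ‖gradient (perf M pol) (θ t ω)‖ ^ 2) μ := hJ.add (hg2.const_mul _)
  have i2 : Integrable (fun ω => perf M pol (θ t ω) +
      stepSize k m t / 2 * ‖gradient (perf M pol) (θ t ω)‖ ^ 2 +
      stepSize k m t / 8 * ‖u t ω‖ ^ 2) μ := i1.add (hu2.const_mul _)
  rw [← integral_const_mul, ← integral_const_mul, ← integral_const_mul,
    ← integral_add hJ (hg2.const_mul _), ← integral_add i1 (hu2.const_mul _),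
    ← integral_sub i2 (he2.const_mul _)]
  refine integral_mono (i2.sub (he2.const_mul _)) hJ' fun ω => ?_
  simp only [hrun.θ_succ t h1 hT ω]
  exact add_le_of_inexact_ascent (h.differentiable_perf (M := M))
    (h.norm_gradient_perf_sub_le M hMg hMh) hη hΛ (θ t ω) (u t ω)

end IsRun

end PolicyGradient

namespace PolicyGradient

/-! ### Rates and sample complexity -/

section Rates

theorem one_le_log_add_two {T : ℕ} (hT : 1 ≤ T) : 1 ≤ Real.log (T + 2) := by
  have h1 : (1 : ℝ) ≤ T := by exact_mod_cast hT
  rw [Real.le_log_iff_exp_le (by linarith)]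
  have := Real.exp_one_lt_three
  linarith

/-- From a bound on weighted second moments to a bound on the mean of first moments. -/
theorem mean_le_of_sum_stepSize_mul_le {k m Γ : ℝ} {T : ℕ} {n f : ℕ → ℝ} (hk : 0 < k)
    (hm : 2 ≤ m) (hT : 1 ≤ T) (hfn : ∀ t ∈ Finset.Icc 1 T, f t ^ 2 ≤ n t)
    (h : ∑ t ∈ Finset.Icc 1 T, stepSize k m t * n t ≤ k * Γ) :
    1 / (T : ℝ) * ∑ t ∈ Finset.Icc 1 T, f t ≤
      √Γ * m ^ (1 / 6 : ℝ) / √(T : ℝ) + √Γ / (T : ℝ) ^ (1 / 3 : ℝ) := by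
  have hT0 : (0 : ℝ) < T := by exact_mod_cast hT
  have hn : ∀ t ∈ Finset.Icc 1 T, 0 ≤ n t := fun t ht => (sq_nonneg _).trans (hfn t ht)
  have hmT : 0 < m + T := by linarith
  have hη := stepSize_pos hk hm T
  -- Step sizes decrease, so every weight may be replaced by the last one.
  have h1 : stepSize k m T * ∑ t ∈ Finset.Icc 1 T, n t ≤ k * Γ := by
    refine le_trans ?_ h
    rw [Finset.mul_sum]
    refine Finset.sum_le_sum fun t ht => ?_
    exact mul_le_mul_of_nonneg_right (stepSize_anti hk hm (Finset.mem_Icc.1 ht).2) (hn t ht)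
  have h2 : ∑ t ∈ Finset.Icc 1 T, n t ≤ Γ * (m + T) ^ (1 / 3 : ℝ) := by
    have h3 : (0 : ℝ) < (m + T) ^ (1 / 3 : ℝ) := by positivity
    rw [stepSize, div_mul_eq_mul_div, div_le_iff₀ h3, mul_assoc] at h1
    exact le_of_mul_le_mul_left h1 hk
  have hΓ : 0 ≤ Γ := by
    have h3 : (0 : ℝ) < (m + T) ^ (1 / 3 : ℝ) := by positivity
    exact nonneg_of_mul_nonneg_left ((Finset.sum_nonneg hn).trans h2) h3
  have h3 : (∑ t ∈ Finset.Icc 1 T, f t) ^ 2 ≤ T * (Γ * (m + T) ^ (1 / 3 : ℝ)) := by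
    have := sq_sum_le_card_mul_sum_sq (s := Finset.Icc 1 T) (f := f)
    rw [Nat.card_Icc, Nat.add_sub_cancel] at this
    refine this.trans ?_
    gcongr
    exact (Finset.sum_le_sum hfn).trans h2
  have hsqT : √(T : ℝ) = (T : ℝ) ^ (1 / 6 : ℝ) * (T : ℝ) ^ (1 / 3 : ℝ) := by
    rw [Real.sqrt_eq_rpow, ← Real.rpow_add hT0]
    norm_num
  have h4 : ∑ t ∈ Finset.Icc 1 T, f t ≤ √(T : ℝ) * (√Γ * (m + T) ^ (1 / 6 : ℝ)) := by
    refine (Real.le_sqrt_of_sq_le h3).trans (le_of_eq ?_)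
    rw [Real.sqrt_mul hT0.le, Real.sqrt_mul hΓ, Real.sqrt_eq_rpow ((m + T) ^ (1 / 3 : ℝ)),
      ← Real.rpow_mul hmT.le]
    norm_num
  have h5 : (m + T) ^ (1 / 6 : ℝ) ≤ m ^ (1 / 6 : ℝ) + (T : ℝ) ^ (1 / 6 : ℝ) :=
    Real.rpow_add_le_add_rpow (by linarith) hT0.le (by norm_num) (by norm_num)
  have hs : 0 < √(T : ℝ) := Real.sqrt_pos.2 hT0
  have hss : √(T : ℝ) * √(T : ℝ) = T := Real.mul_self_sqrt hT0.le
  calc 1 / (T : ℝ) * ∑ t ∈ Finset.Icc 1 T, f t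
      ≤ 1 / (T : ℝ) * (√(T : ℝ) * (√Γ * (m ^ (1 / 6 : ℝ) + (T : ℝ) ^ (1 / 6 : ℝ)))) := by
        gcongr
        exact h4.trans (by gcongr)
    _ = √Γ * m ^ (1 / 6 : ℝ) / √(T : ℝ) + √Γ * ((T : ℝ) ^ (1 / 6 : ℝ) / √(T : ℝ)) := by
        have e : 1 / (T : ℝ) = 1 / (√(T : ℝ) * √(T : ℝ)) := by rw [hss]
        rw [e]
        field_simp
    _ = _ := by
        rw [hsqT]
        field_simp

/-- Put l = log(1/ε) and T = x · ε⁻³ l^(3/2). Then ε² T^(2/3) = x^(2/3) l, while log(T+2) ≤ l (2 log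
x + 7). The factor l cancels, and what is left is an inequality in x alone that holds for all large
x; C is such a threshold. -/
theorem exists_sample_complexity (K : ℝ) (hK : 0 < K) :
    ∃ C : ℝ, 0 < C ∧ ∀ ε : ℝ, 0 < ε → ε ≤ 1 / 2 → ∀ T : ℕ,
      C * (1 / ε) ^ 3 * Real.log (1 / ε) ^ (3 / 2 : ℝ) ≤ (T : ℝ) →
      1 ≤ T ∧ K * Real.log (T + 2) ≤ ε ^ 2 * (T : ℝ) ^ (2 / 3 : ℝ) := by
  have hev : ∀ᶠ x : ℝ in atTop, K * (2 * Real.log x + 7) ≤ x ^ (2 / 3 : ℝ) := by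
    have h1 : (fun x : ℝ => K * (2 * Real.log x + 7)) =o[atTop] fun x : ℝ => x ^ (2 / 3 : ℝ) := by
      refine Asymptotics.IsLittleO.const_mul_left (Asymptotics.IsLittleO.add
        ((isLittleO_log_rpow_atTop (by norm_num)).const_mul_left 2) ?_) K
      exact Asymptotics.isLittleO_const_left.2
        (Or.inr (tendsto_norm_atTop_atTop.comp (tendsto_rpow_atTop (by norm_num))))
    filter_upwards [h1.bound one_pos, eventually_ge_atTop 0] with x hx hx0
    rw [one_mul, Real.norm_of_nonneg (by positivity : 0 ≤ x ^ (2 / 3 : ℝ))] at hx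
    exact (le_abs_self _).trans hx
  obtain ⟨C, hC⟩ := eventually_atTop.1 (hev.and (eventually_ge_atTop 1))
  refine ⟨C, zero_lt_one.trans_le (hC C le_rfl).2, fun ε hε hε2 T hT => ?_⟩
  have hC1 := (hC C le_rfl).2
  set l := Real.log (1 / ε) with hl
  -- This is where ε ≤ 1/2 enters: l stays away from 0, so log x can be absorbed into 2 l log x.
  have hl2 : 1 / 2 < l := by
    have h1 : Real.log 2 ≤ l := Real.log_le_log (by norm_num) (by
      rw [le_div_iff₀ hε]
      linarith)
    have := Real.log_two_gt_d9
    linarith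
  have hl0 : 0 < l := by linarith
  set D := (1 / ε) ^ 3 * l ^ (3 / 2 : ℝ) with hD
  have hD0 : 0 < D := by positivity
  have hTpos : (0 : ℝ) < T := by
    refine lt_of_lt_of_le ?_ hT
    positivity
  have hT1 : 1 ≤ T := by exact_mod_cast hTpos
  refine ⟨hT1, ?_⟩
  set x := (T : ℝ) / D with hx
  have hxC : C ≤ x := by
    rw [hx, le_div_iff₀ hD0, hD, ← mul_assoc]
    exact hT
  have hx1 : 1 ≤ x := hC1.trans hxC
  have hx0 : 0 < x := by linarith
  have hTx : (T : ℝ) = x * D := by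
    rw [hx, div_mul_cancel₀ _ hD0.ne']
  have hlogx : 0 ≤ Real.log x := Real.log_nonneg hx1
  have hlog : Real.log (T + 2) ≤ l * (2 * Real.log x + 7) := by
    have h1 : Real.log (T + 2) ≤ Real.log (3 * T) := by
      have : (1 : ℝ) ≤ T := by exact_mod_cast hT1
      exact Real.log_le_log (by linarith) (by linarith)
    have h2 : Real.log (3 * T) = Real.log 3 + (Real.log x + (3 * l + 3 / 2 * Real.log l)) := by
      rw [hTx, Real.log_mul (by norm_num) (by positivity), Real.log_mul hx0.ne' hD0.ne', hD,
        Real.log_mul (by positivity) (by positivity), Real.log_pow, Real.log_rpow hl0, ← hl]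
      norm_num
    have h3 : Real.log 3 ≤ 5 / 4 := by
      rw [Real.log_le_iff_le_exp (by norm_num)]
      have h4 : Real.exp (5 / 4) = Real.exp 1 * Real.exp (1 / 4) := by
        rw [← Real.exp_add]
        norm_num
      have h5 := Real.exp_one_gt_d9
      have h6 := Real.add_one_le_exp (1 / 4 : ℝ)
      rw [h4]
      nlinarith
    have h4 : Real.log l ≤ l - 1 := Real.log_le_sub_one_of_pos hl0
    nlinarith
  have hpow : (T : ℝ) ^ (2 / 3 : ℝ) = x ^ (2 / 3 : ℝ) * ((1 / ε) ^ 2 * l) := by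
    rw [hTx, Real.mul_rpow hx0.le hD0.le, hD, Real.mul_rpow (by positivity) (by positivity),
      ← Real.rpow_mul hl0.le, ← Real.rpow_natCast, ← Real.rpow_mul (by positivity),
      ← Real.rpow_natCast (1 / ε) 2]
    norm_num
  calc K * Real.log (T + 2) ≤ K * (l * (2 * Real.log x + 7)) := by gcongr
    _ = K * (2 * Real.log x + 7) * l := by ring
    _ ≤ x ^ (2 / 3 : ℝ) * l := by
        gcongr
        exact (hC x hxC).1
    _ = ε ^ 2 * (T : ℝ) ^ (2 / 3 : ℝ) := by
        rw [hpow]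
        field_simp

theorem isBigO_add_mul_log (a b : ℝ) :
    (fun T : ℕ => a + b * Real.log ((T : ℝ) + 2)) =O[atTop] fun T : ℕ => Real.log (T : ℝ) := by
  have h0 : Tendsto (fun T : ℕ => Real.log (T : ℝ)) atTop atTop :=
    Real.tendsto_log_atTop.comp tendsto_natCast_atTop_atTop
  refine Asymptotics.IsBigO.add ?_ (Asymptotics.IsBigO.const_mul_left ?_ b)
  · exact (Asymptotics.isLittleO_const_left.2
      (Or.inr (tendsto_norm_atTop_atTop.comp h0))).isBigO
  · refine Asymptotics.IsBigO.of_bound 2 ?_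
    filter_upwards [eventually_ge_atTop 2] with T hT
    have hT2 : (2 : ℝ) ≤ T := by exact_mod_cast hT
    rw [Real.norm_of_nonneg (Real.log_nonneg (by linarith)),
      Real.norm_of_nonneg (Real.log_nonneg (by linarith))]
    have : (2 : ℝ) * Real.log T = Real.log ((T : ℝ) ^ 2) := by
      rw [Real.log_pow]
      norm_num
    rw [this]
    exact Real.log_le_log (by linarith) (by nlinarith)

/-- A bound with logarithmic `Γ` is at most of order `√(log T) / T ^ (1/3)`. -/
theorem rate_le_of_log_bound {Γ K q ε : ℝ} {T : ℕ} (hT : 1 ≤ T) (hq : 0 ≤ q) (hε : 0 < ε)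
    (hΓ : Γ ≤ K * Real.log (T + 2))
    (h : K * (q + 1) ^ 2 * Real.log (T + 2) ≤ ε ^ 2 * (T : ℝ) ^ (2 / 3 : ℝ)) :
    √Γ * q / √(T : ℝ) + √Γ / (T : ℝ) ^ (1 / 3 : ℝ) ≤ ε := by
  have hT1 : (1 : ℝ) ≤ T := by exact_mod_cast hT
  have hT0 : (0 : ℝ) < T := by linarith
  have h1 : (T : ℝ) ^ (1 / 3 : ℝ) ≤ √(T : ℝ) := by
    rw [Real.sqrt_eq_rpow]
    exact Real.rpow_le_rpow_of_exponent_le hT1 (by norm_num)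
  have h2 : 0 < (T : ℝ) ^ (1 / 3 : ℝ) := by positivity
  have h3 : √Γ * (q + 1) ≤ ε * (T : ℝ) ^ (1 / 3 : ℝ) := by
    refine le_of_sq_le_sq ?_ (by positivity)
    rcases le_total Γ 0 with h0 | h0
    · rw [Real.sqrt_eq_zero'.2 h0]
      simp
      positivity
    · rw [mul_pow, Real.sq_sqrt h0, mul_pow, ← Real.rpow_natCast (_ ^ _), ← Real.rpow_mul hT0.le]
      norm_num at h ⊢
      have : Γ * (q + 1) ^ 2 ≤ K * Real.log (T + 2) * (q + 1) ^ 2 := by gcongr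
      linarith
  calc √Γ * q / √(T : ℝ) + √Γ / (T : ℝ) ^ (1 / 3 : ℝ)
      ≤ √Γ * q / (T : ℝ) ^ (1 / 3 : ℝ) + √Γ / (T : ℝ) ^ (1 / 3 : ℝ) := by gcongr
    _ = √Γ * (q + 1) / (T : ℝ) ^ (1 / 3 : ℝ) := by ring
    _ ≤ ε := by rwa [div_le_iff₀ h2]

end Rates

end PolicyGradient

/-! ### Assembly -/

namespace PolicyGradient

variable {S A : Type*} [MeasurableSpace S] [MeasurableSpace A] {d : ℕ} {ν : Measure A}
  {M : MDP S A} {pol : PolicyFamily d S ν} {Mg Mh : ℝ}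

theorem IsRun.mean_gradient_norm_le {k m c : ℝ} {θ₁ : EuclideanSpace ℝ (Fin d)} {T : ℕ}
    {Ω : Type*} [mΩ : MeasurableSpace Ω] {μ : Measure Ω} {ℱ : Filtration ℕ mΩ}
    {τ : ℕ → Ω → Traj S A M.H} {θ u : ℕ → Ω → EuclideanSpace ℝ (Fin d)} {ζ : Ω → ℕ} [SFinite ν]
    [IsProbabilityMeasure μ] (hrun : IsRun M pol k m c θ₁ T μ ℱ τ θ u ζ) (hT : 1 ≤ T)
    (h : BoundedScore pol Mg Mh) {σ W L B Js Γ : ℝ} (hg : BoundedGradientVariance M pol σ)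
    (hw : BoundedWeightVariance M pol W) (hMg : 0 ≤ Mg) (hMh : 0 ≤ Mh) (hW : 0 ≤ W)
    (hk : 0 < k) (hL : 0 < L) (hB : 0 < B) (hc : c = 1 / (3 * k ^ 3 * L) + 104 * B ^ 2)
    (hm : 2 ≤ m) (hm1 : (2 * L * k) ^ 3 ≤ m) (hm2 : (c * k / (2 * L)) ^ 3 ≤ m)
    (hBb : (Mh * M.R / (1 - M.γ) ^ 2) ^ 2 +
          (Mg * M.R / (1 - M.γ) ^ 2) ^ 2 * (M.H ^ 2 * Mg ^ 2 * (W + 1)) ≤ B ^ 2)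
    (hΛ : (Mh * M.R + M.H * Mg ^ 2 * M.R) / (1 - M.γ) ^ 2 ≤ 3 / 2 * L)
    (hJs : ∀ θ, perf M pol θ ≤ Js)
    (hΓ : 2 * (Js - perf M pol θ₁) + m ^ (1 / 3 : ℝ) / (16 * B ^ 2 * k) * σ ^ 2 +
      c ^ 2 * k ^ 3 * σ ^ 2 / (8 * B ^ 2) * Real.log (T + 2) ≤ k * Γ) :
    (∀ t, 1 ≤ t → t ≤ T → Integrable (fun ω => ‖gradient (perf M pol) (θ t ω)‖) μ) ∧
    Integrable (fun ω => ‖gradient (perf M pol) (θ (ζ ω) ω)‖) μ ∧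
    ∫ ω, ‖gradient (perf M pol) (θ (ζ ω) ω)‖ ∂μ
      = 1 / (T : ℝ) * ∑ t ∈ Finset.Icc 1 T, ∫ ω, ‖gradient (perf M pol) (θ t ω)‖ ∂μ ∧
    1 / (T : ℝ) * ∑ t ∈ Finset.Icc 1 T, ∫ ω, ‖gradient (perf M pol) (θ t ω)‖ ∂μ
      ≤ √Γ * m ^ (1 / 6 : ℝ) / √(T : ℝ) + √Γ / (T : ℝ) ^ (1 / 3 : ℝ) := by
  have hc0 : 0 ≤ c := by
    rw [hc]
    positivity
  have hη : ∀ t, 0 < stepSize k m t := stepSize_pos hk hm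
  have hβ0 : ∀ t, 0 ≤ c * stepSize k m t ^ 2 := fun t => by positivity
  have hβ1 := mul_stepSize_sq_le_one hk hL hc0 hm hm1 hm2
  have hΛη : ∀ t, (Mh * M.R + M.H * Mg ^ 2 * M.R) / (1 - M.γ) ^ 2 * stepSize k m t ≤ 3 / 4 := by
    intro t
    have h1 := stepSize_le (x := 2 * L) hk hm (by convert hm1 using 1; ring) t
    have h2 := mul_le_mul_of_nonneg_right hΛ (hη t).le
    linarith
  have hu : ∀ t, 1 ≤ t → t ≤ T → MemLp (u t) 2 μ := fun t h1 h2 =>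
    hrun.memLp_u h hg hw hMg hMh hW hβ0 hβ1 h1 h2
  have hgL : ∀ t, 1 ≤ t → t ≤ T → MemLp (fun ω => gradient (perf M pol) (θ t ω)) 2 μ :=
    fun t h1 h2 => hrun.memLp_gradient h hMg hMh h1 (by omega) 2
  have hgi : ∀ t, 1 ≤ t → t ≤ T → Integrable (fun ω => ‖gradient (perf M pol) (θ t ω)‖) μ :=
    fun t h1 h2 => ((hgL t h1 h2).integrable one_le_two).norm
  have hgm : ∀ t, 1 ≤ t → t ≤ T → Measurable[ℱ T] fun ω => ‖gradient (perf M pol) (θ t ω)‖ := by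
    intro t h1 h2
    have hθ : Measurable[ℱ T] (θ t) :=
      (hrun.measurable_θ h h1 (by omega)).mono (ℱ.mono (by omega)) le_rfl
    exact ((h.continuous_gradient_perf hMg hMh).norm.measurable).comp hθ
  obtain ⟨hζi, hζ⟩ := integral_uniform_time
    (f := fun t ω => ‖gradient (perf M pol) (θ t ω)‖) hrun.measurable_ζ hT hrun.uniform_ζ
    hrun.indep_ζ hgm hgi
  refine ⟨hgi, hζi, hζ, mean_le_of_sum_stepSize_mul_le hk hm hT
    (n := fun t => ∫ ω, ‖gradient (perf M pol) (θ t ω)‖ ^ 2 ∂μ) (fun t ht => ?_) ?_⟩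
  · obtain ⟨h1, h2⟩ := Finset.mem_Icc.1 ht
    -- Jensen's inequality (E f)² ≤ E f², in the form of nonnegativity of the variance.
    have hv := variance_nonneg (fun ω => ‖gradient (perf M pol) (θ t ω)‖) μ
    rw [variance_eq_sub (hgL t h1 h2).norm] at hv
    simp only [Pi.pow_apply] at hv
    linarith
  -- A run of T iterations does not constrain u_{T+1}, yet the potential argument refers to a (T+1).
  -- Setting it to 0 makes the last recursion trivial and keeps a ≥ 0.
  · set a : ℕ → ℝ := fun t => if t ≤ T then
      ∫ ω, ‖u t ω - gradient (perf M pol) (θ t ω)‖ ^ 2 ∂μ else 0 with ha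
    have ha_of_le : ∀ t, t ≤ T → a t = ∫ ω, ‖u t ω - gradient (perf M pol) (θ t ω)‖ ^ 2 ∂μ :=
      fun t ht => if_pos ht
    have ha0 : ∀ t, 0 ≤ a t := by
      intro t
      simp only [ha]
      split_ifs
      · exact integral_nonneg fun ω => by positivity
      · exact le_rfl
    refine (sum_stepSize_mul_le (a := a) (b := fun t => ∫ ω, ‖u t ω‖ ^ 2 ∂μ)
      (j := fun t => ∫ ω, perf M pol (θ t ω) ∂μ) (σ := σ) (Js := Js) (j₁ := perf M pol θ₁)
      hk hL hB hc hm hm1 hm2 ha0 ?_ ?_ ?_ ?_ ?_).trans hΓ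
    · rw [ha_of_le 1 hT]
      exact hrun.integral_error_one_le h hg hMg hMh hT
    · intro t h1 h2
      rcases h2.lt_or_eq with h3 | h3
      · rw [ha_of_le t h2, ha_of_le (t + 1) h3]
        exact (hrun.error_succ h hg hw hMg hMh hW hBb h1 h3 (hβ0 t) (hβ1 t) (hu t h1 h2)).2
      · have e : a (t + 1) = 0 := if_neg (by omega)
        have h4 : 0 ≤ ∫ ω, ‖u t ω‖ ^ 2 ∂μ := integral_nonneg fun ω => by positivity
        have h5 := ha0 t
        rw [e]
        positivity
    · intro t h1 h2
      rw [ha_of_le t h2]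
      exact hrun.integral_perf_succ_ge h hMg hMh h1 h2 (hu t h1 h2) (hη t).le (hΛη t)
    · simp [hrun.init]
    · simpa using integral_mono (hrun.integrable_perf h (t := T + 1) (by omega) le_rfl)
        (integrable_const Js) fun ω => hJs (θ (T + 1) ω)

theorem bddAbove_range_perf (M : MDP S A) (pol : PolicyFamily d S ν) [SFinite ν] :
    BddAbove (Set.range (perf M pol)) :=
  ⟨M.R / (1 - M.γ), by
    rintro _ ⟨θ, rfl⟩
    exact (abs_le.1 (abs_perf_le M pol θ)).2⟩

/-- The Lipschitz constant of ∇J is a sum x + y, while L only controls √(x² + y²); the loss is √2 ≤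
3/2. Together with 2Lη ≤ 1 this yields the 3/4 required by the ascent step. -/
theorem smoothness_le (M : MDP S A) {L : ℝ}
    (hL : √(((M.H : ℝ) ^ 2 * Mg ^ 4 * M.R ^ 2 + Mh ^ 2 * M.R ^ 2) / (1 - M.γ) ^ 4) ≤ L) :
    (Mh * M.R + M.H * Mg ^ 2 * M.R) / (1 - M.γ) ^ 2 ≤ 3 / 2 * L := by
  have h1 : 0 < 1 - M.γ := sub_pos.2 M.γ_lt_one
  have hL0 : 0 ≤ L := (Real.sqrt_nonneg _).trans hL
  rw [Real.sqrt_le_left hL0, div_le_iff₀ (by positivity)] at hL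
  rw [div_le_iff₀ (by positivity)]
  refine le_of_sq_le_sq ?_ (by positivity)
  have h2 : (3 / 2 * L * (1 - M.γ) ^ 2) ^ 2 = 9 / 4 * (L ^ 2 * (1 - M.γ) ^ 4) := by ring
  rw [h2]
  nlinarith [sq_nonneg (Mh * M.R - M.H * Mg ^ 2 * M.R), sq_nonneg (Mh * M.R),
    sq_nonneg (M.H * Mg ^ 2 * M.R)]

end PolicyGradient

theorem theorem3 {S A : Type*} [MeasurableSpace S] [MeasurableSpace A] {d : ℕ}
    (M : PolicyGradient.MDP S A) (ν : Measure A) [SigmaFinite ν]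
    (pol : PolicyGradient.PolicyFamily d S ν)
    (Mg Mh σ W k : ℝ) (hMg : 0 < Mg) (hMh : 0 < Mh) (hσ : 0 < σ) (hW : 0 < W) (hk : 0 < k)
    (hscore : PolicyGradient.BoundedScore pol Mg Mh)
    (hgrad : PolicyGradient.BoundedGradientVariance M pol σ)
    (hweight : PolicyGradient.BoundedWeightVariance M pol W)
    (θ₁ : EuclideanSpace ℝ (Fin d))
    (J : EuclideanSpace ℝ (Fin d) → ℝ) (hJ : J = PolicyGradient.perf M pol)
    (Jstar : ℝ) (hJstar : Jstar = ⨆ θ, J θ)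
    (G L Cw B c m : ℝ) (Γ : ℕ → ℝ)
    (hG : G = Mg * M.R / (1 - M.γ) ^ 2)
    (hL : L = max (Mh * M.R / (1 - M.γ) ^ 2)
      (√(((M.H : ℝ) ^ 2 * Mg ^ 4 * M.R ^ 2 + Mh ^ 2 * M.R ^ 2) / (1 - M.γ) ^ 4)))
    (hCw : Cw = √((M.H : ℝ) * (2 * (M.H : ℝ) * Mg ^ 2 + Mh) * (W + 1)))
    (hB : B = √(L ^ 2 + 2 * G ^ 2 * Cw ^ 2))
    (hc : c = 1 / (3 * k ^ 3 * L) + 104 * B ^ 2)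
    (hm : m = max 2 (max ((2 * L * k) ^ 3) ((c * k / (2 * L)) ^ 3)))
    (hΓ : ∀ T : ℕ, Γ T = 1 / k * (16 * (Jstar - J θ₁)
      + m ^ (1 / 3 : ℝ) / (8 * B ^ 2 * k) * σ ^ 2
      + c ^ 2 * k ^ 3 * σ ^ 2 / (4 * B ^ 2) * Real.log ((T : ℝ) + 2))) :
    Differentiable ℝ J ∧ BddAbove (Set.range J) ∧
    Γ =O[atTop] (fun T : ℕ => Real.log (T : ℝ)) ∧
    (∀ (Ω : Type*) [mΩ : MeasurableSpace Ω] (μ : Measure Ω) [IsProbabilityMeasure μ]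
      (ℱ : Filtration ℕ mΩ) (τ : ℕ → Ω → PolicyGradient.Traj S A M.H)
      (θ u : ℕ → Ω → EuclideanSpace ℝ (Fin d)) (ζ : Ω → ℕ) (T : ℕ), 1 ≤ T →
      PolicyGradient.IsRun M pol k m c θ₁ T μ ℱ τ θ u ζ →
      (∀ t, 1 ≤ t → t ≤ T → Integrable (fun ω => ‖gradient J (θ t ω)‖) μ) ∧
      Integrable (fun ω => ‖gradient J (θ (ζ ω) ω)‖) μ ∧
      ∫ ω, ‖gradient J (θ (ζ ω) ω)‖ ∂μ
        = 1 / (T : ℝ) * ∑ t ∈ Finset.Icc 1 T, ∫ ω, ‖gradient J (θ t ω)‖ ∂μ ∧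
      1 / (T : ℝ) * ∑ t ∈ Finset.Icc 1 T, ∫ ω, ‖gradient J (θ t ω)‖ ∂μ
        ≤ √(Γ T) * m ^ (1 / 6 : ℝ) / √(T : ℝ) + √(Γ T) / (T : ℝ) ^ (1 / 3 : ℝ)) ∧
    (∃ C : ℝ, 0 < C ∧ ∀ ε : ℝ, 0 < ε → ε ≤ 1 / 2 →
      ∀ (Ω : Type*) [mΩ : MeasurableSpace Ω] (μ : Measure Ω) [IsProbabilityMeasure μ]
      (ℱ : Filtration ℕ mΩ) (τ : ℕ → Ω → PolicyGradient.Traj S A M.H)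
      (θ u : ℕ → Ω → EuclideanSpace ℝ (Fin d)) (ζ : Ω → ℕ) (T : ℕ),
      C * (1 / ε) ^ 3 * Real.log (1 / ε) ^ (3 / 2 : ℝ) ≤ (T : ℝ) →
      PolicyGradient.IsRun M pol k m c θ₁ T μ ℱ τ θ u ζ →
      ∫ ω, ‖gradient J (θ (ζ ω) ω)‖ ∂μ ≤ ε) := by

  have hR := M.R_pos
  have h1γ : 0 < 1 - M.γ := sub_pos.2 M.γ_lt_one
  have hLg : Mh * M.R / (1 - M.γ) ^ 2 ≤ L := hL ▸ le_max_left _ _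
  have hLg0 : 0 < Mh * M.R / (1 - M.γ) ^ 2 := by positivity
  have hL0 : 0 < L := hLg0.trans_le hLg
  have hΛ := PolicyGradient.smoothness_le M (hL ▸ le_max_right _ _)
  have hCw2 : Cw ^ 2 = (M.H : ℝ) * (2 * (M.H : ℝ) * Mg ^ 2 + Mh) * (W + 1) := by
    rw [hCw, Real.sq_sqrt (by positivity)]
  have hB2 : B ^ 2 = L ^ 2 + 2 * G ^ 2 * Cw ^ 2 := by
    rw [hB, Real.sq_sqrt (by positivity)]
  have hB0 : 0 < B := by
    rw [hB]
    positivity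
  -- 2 G² Cw² contains G² H² Mg² (W+1) with room to spare; the surplus, including the Mh part of
  -- Cw², is dropped.
  have hBb : (Mh * M.R / (1 - M.γ) ^ 2) ^ 2 +
      (Mg * M.R / (1 - M.γ) ^ 2) ^ 2 * (M.H ^ 2 * Mg ^ 2 * (W + 1)) ≤ B ^ 2 := by
    rw [← hG, hB2, hCw2]
    have h1 : (Mh * M.R / (1 - M.γ) ^ 2) ^ 2 ≤ L ^ 2 := by gcongr
    have h2 : 0 ≤ G ^ 2 * ((M.H : ℝ) ^ 2 * Mg ^ 2 * (W + 1)) := by positivity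
    have h3 : 0 ≤ G ^ 2 * ((M.H : ℝ) * Mh * (W + 1)) := by positivity
    linarith
  have hm2 : 2 ≤ m := hm ▸ le_max_left _ _
  have hm3 : (2 * L * k) ^ 3 ≤ m := hm ▸ (le_max_left _ _).trans (le_max_right _ _)
  have hm4 : (c * k / (2 * L)) ^ 3 ≤ m := hm ▸ (le_max_right _ _).trans (le_max_right _ _)
  have hm0 : 0 < m := by linarith
  have hbdd := PolicyGradient.bddAbove_range_perf M pol
  have hJs : ∀ θ, PolicyGradient.perf M pol θ ≤ Jstar := fun θ => by
    rw [hJstar, hJ]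
    exact le_ciSup hbdd θ
  have hJ0 : 0 ≤ Jstar - J θ₁ := by
    rw [hJ]
    linarith [hJs θ₁]
  have hΓb : ∀ T : ℕ, 1 ≤ T → 2 * (Jstar - PolicyGradient.perf M pol θ₁) +
      m ^ (1 / 3 : ℝ) / (16 * B ^ 2 * k) * σ ^ 2 +
      c ^ 2 * k ^ 3 * σ ^ 2 / (8 * B ^ 2) * Real.log (T + 2) ≤ k * Γ T := by
    intro T hT
    have hlog := PolicyGradient.one_le_log_add_two hT
    have e : k * Γ T = 16 * (Jstar - J θ₁) + m ^ (1 / 3 : ℝ) / (8 * B ^ 2 * k) * σ ^ 2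
      + c ^ 2 * k ^ 3 * σ ^ 2 / (4 * B ^ 2) * Real.log ((T : ℝ) + 2) := by
      rw [hΓ]
      field_simp
    rw [e, ← hJ]
    -- Coefficient by coefficient: 2 ≤ 16, 1/16 ≤ 1/8 and 1/8 ≤ 1/4.
    gcongr <;> norm_num
  set Ka := 1 / k * (16 * (Jstar - J θ₁) + m ^ (1 / 3 : ℝ) / (8 * B ^ 2 * k) * σ ^ 2) with hKa
  set Kb := 1 / k * (c ^ 2 * k ^ 3 * σ ^ 2 / (4 * B ^ 2)) with hKb
  have hΓ' : Γ = fun T : ℕ => Ka + Kb * Real.log ((T : ℝ) + 2) := by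
    funext T
    rw [hΓ, hKa, hKb]
    ring
  have hc0 : 0 < c := by
    rw [hc]
    positivity
  have hKa0 : 0 ≤ Ka := by positivity
  have hKb0 : 0 < Kb := by positivity
  refine ⟨hJ ▸ hscore.differentiable_perf, hJ ▸ hbdd, ?_, ?_, ?_⟩
  · rw [hΓ']
    exact PolicyGradient.isBigO_add_mul_log Ka Kb
  · intro Ω mΩ μ _ ℱ τ θ u ζ T hT hrun
    rw [hJ]
    exact hrun.mean_gradient_norm_le hT hscore hgrad hweight hMg.le hMh.le hW.le hk hL0 hB0 hc
      hm2 hm3 hm4 hBb hΛ hJs (hΓb T hT)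
  -- Since log(T+2) ≥ 1, Γ T is at most (Ka + Kb) log(T+2). Since √T ≥ T^(1/3), both terms of the
  -- rate have order T^(-1/3), with joint factor m^(1/6) + 1, squared here.
  · obtain ⟨C, hC, hCT⟩ := PolicyGradient.exists_sample_complexity
      ((Ka + Kb) * (m ^ (1 / 6 : ℝ) + 1) ^ 2) (by positivity)
    refine ⟨C, hC, fun ε hε hε2 Ω mΩ μ _ ℱ τ θ u ζ T hT hrun => ?_⟩
    obtain ⟨hT1, hT2⟩ := hCT ε hε hε2 T hT
    obtain ⟨-, -, h1, h2⟩ := hrun.mean_gradient_norm_le hT1 hscore hgrad hweight hMg.le hMh.le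
      hW.le hk hL0 hB0 hc hm2 hm3 hm4 hBb hΛ hJs (hΓb T hT1)
    rw [hJ, h1]
    refine h2.trans (PolicyGradient.rate_le_of_log_bound hT1 (by positivity) hε ?_ hT2)
    rw [hΓ']
    have := mul_le_mul_of_nonneg_left (PolicyGradient.one_le_log_add_two hT1) hKa0
    simp only
    linarith
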